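/- **Lemma 2.1.** Let $\alpha>0$ and put $$\psi_0=\frac{1}{\sqrt{2(1+2\cosh^2\alpha)}},\qquad A=\frac{\sqrt2\,\sinh\alpha}{\sqrt{1+2\cosh^2\alpha}},\qquad u_\pm(x)=\psi_0\left(1+\frac{2\sinh^2\alpha}{1\pm\cosh\alpha\cosh(Ax)}\right)\quad(x\in\mathbb R).$$ Let $u$ be either $u_+$ or $u_-$. On the complex Hilbert space $L^2(\mathbb R)\times L^2(\mathbb R)$ consider the operator $\mathcal J\mathcal L$ with domain $H^2(\mathbb R)\times H^2(\mathbb R)$, where $$\mathcal J=\begin{pmatrix}0&1\\-1&0\end{pmatrix},\qquad \mathcal L=\begin{pmatrix}\mathcal L_+&0\\0&\mathcal L_-\end{pmatrix},\qquad \mathcal L_+=-\partial_{xx}+1-6u^2,\qquad \mathcal L_-=-\partial_{xx}+1-2u^2 .$$ For a closed operator $T$ let $\sigma_{p.p.}(T)$ be the set of isolated points of the spectrum $\sigma(T)$ that are eigenvalues of finite algebraic multiplicity (that is, whose Riesz projection has finite rank), and let $\sigma_{ess}(T)=\sigma(T)\setminus\sigma_{p.p.}(T)$. Then $$\sigma_{ess}(\mathcal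 J\mathcal L)=\left\{i\lambda:\ \lambda\in\mathbb R,\ |\lambda|\ge\sqrt{(1-6\psi_0^2)(1-2\psi_0^2)}\right\}.$$ -/

import Mathlib

open MeasureTheory Filter Topology
open scoped ENNReal SchwartzMap LineDeriv

/-! ### Spectral theory of unbounded operators on a complex Banach space -/

namespace UnboundedOperator

variable {H : Type*} [NormedAddCommGroup H] [NormedSpace ℂ H]

/-- The linear map `A - z`, defined on the domain of `A`. -/
def shift (A : H →ₗ.[ℂ] H) (z : ℂ) : A.domain →ₗ[ℂ] H :=
  A.toFun - z • A.domain.subtype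

/-- The resolvent set: all `z` such that `A - z : D(A) → H` has a bounded two-sided inverse
`R : H → D(A)`. -/
def resolventSet (A : H →ₗ.[ℂ] H) : Set ℂ :=
  {z | ∃ R : H →L[ℂ] H,
    (∀ y : H, ∃ hy : R y ∈ A.domain, shift A z ⟨R y, hy⟩ = y) ∧
    (∀ x : A.domain, R (shift A z x) = x)}

/-- The spectrum of an unbounded operator. -/
def spectrum (A : H →ₗ.[ℂ] H) : Set ℂ := (resolventSet A)ᶜ

/-- The kernel of `(A - z) ^ n`, on its natural domain. -/
def kerPow (A : H →ₗ.[ℂ] H) (z : ℂ) : ℕ → Submodule ℂ H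
  | 0 => ⊥
  | n + 1 => ((kerPow A z n).comap (shift A z)).map A.domain.subtype

/-- The root subspace (generalized eigenspace) `⋃ n, ker (A - z) ^ n`; its dimension is the
algebraic multiplicity of `z`. -/
def rootSubspace (A : H →ₗ.[ℂ] H) (z : ℂ) : Submodule ℂ H := ⨆ n, kerPow A z n

/-- `z` is an isolated eigenvalue of finite algebraic multiplicity (a normal eigenvalue): it is an
isolated point of the spectrum and an eigenvalue, its root subspace is finite dimensional, and the
root subspace has a closed complement, invariant under `A`, on which `A - z` is invertible.
(Equivalently, `z` is an isolated point of the spectrum whose Riesz projection has finite rank.) -/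
structure IsDiscreteEigenvalue (A : H →ₗ.[ℂ] H) (z : ℂ) : Prop where
  isolated : ∀ᶠ w in 𝓝[≠] z, w ∉ spectrum A
  eigenvalue : ∃ x : A.domain, x ≠ 0 ∧ A x = z • (x : H)
  finite_multiplicity : FiniteDimensional ℂ (rootSubspace A z)
  complement : ∃ R : Submodule ℂ H, IsClosed (R : Set H) ∧ IsCompl (rootSubspace A z) R ∧
    (∀ x : A.domain, (x : H) ∈ R → A x ∈ R) ∧
    (∀ y ∈ R, ∃! x : A.domain, (x : H) ∈ R ∧ shift A z x = y)

/-- The pure point (discrete) spectrum: isolated eigenvalues of finite algebraic multiplicity. -/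
def pointSpectrum (A : H →ₗ.[ℂ] H) : Set ℂ := {z | z ∈ spectrum A ∧ IsDiscreteEigenvalue A z}

/-- The essential spectrum: the spectrum without the isolated eigenvalues of finite algebraic
multiplicity. -/
def essentialSpectrum (A : H →ₗ.[ℂ] H) : Set ℂ := spectrum A \ pointSpectrum A

end UnboundedOperator

noncomputable section

namespace LugiatoLefever

/-! ### The steady states -/

/-- The value at infinity `ψ₀(α) = 1 / √(2 (1 + 2 cosh² α))`. -/
def psi0 (α : ℝ) : ℝ := 1 / √(2 * (1 + 2 * Real.cosh α ^ 2))

/-- The rate `A(α) = √2 sinh α / √(1 + 2 cosh² α)`. -/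
def rate (α : ℝ) : ℝ := √2 * Real.sinh α / √(1 + 2 * Real.cosh α ^ 2)

/-- The steady states `u₊` (for `s = 1`) and `u₋` (for `s = -1`):
`u_s(x) = ψ₀ (1 + 2 sinh² α / (1 + s cosh α cosh (A x)))`. -/
def steadyState (s : ℤˣ) (α x : ℝ) : ℝ :=
  psi0 α * (1 + 2 * Real.sinh α ^ 2 /
    (1 + ((s : ℤ) : ℝ) * (Real.cosh α * Real.cosh (rate α * x))))

theorem abs_steadyState_le (s : ℤˣ) (α x : ℝ) :
    |steadyState s α x| ≤ |psi0 α| * (1 + 2 * (Real.cosh α + 1)) := by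
  have h1 : 1 ≤ Real.cosh α := Real.one_le_cosh α
  have h2 : 1 ≤ Real.cosh (rate α * x) := Real.one_le_cosh _
  have h3 : Real.cosh α ≤ Real.cosh α * Real.cosh (rate α * x) := by nlinarith
  have hs : Real.sinh α ^ 2 = (Real.cosh α - 1) * (Real.cosh α + 1) := by
    rw [Real.sinh_sq]; ring
  unfold steadyState
  rw [abs_mul]
  refine mul_le_mul_of_nonneg_left ?_ (abs_nonneg _)
  refine (abs_add_le _ _).trans ?_
  rw [abs_one, abs_div, abs_of_nonneg (by positivity : 0 ≤ 2 * Real.sinh α ^ 2), hs]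
  gcongr
  have hd : Real.cosh α - 1 ≤
      |1 + ((s : ℤ) : ℝ) * (Real.cosh α * Real.cosh (rate α * x))| := by
    rcases Int.units_eq_one_or s with rfl | rfl
    · refine le_trans ?_ (le_abs_self _)
      simp only [Units.val_one, Int.cast_one, one_mul]
      linarith
    · refine le_trans ?_ (neg_le_abs _)
      simp only [Units.val_neg, Units.val_one, Int.cast_neg, Int.cast_one]
      linarith
  refine div_le_of_le_mul₀ (abs_nonneg _) (by positivity) ?_
  nlinarith

/-- The square of a steady state is a bounded measurable function. -/
theorem memLp_steadyState_sq (s : ℤˣ) (α : ℝ) :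
    MemLp (fun x => ((steadyState s α x ^ 2 : ℝ) : ℂ)) ∞ (volume : Measure ℝ) := by
  have hm : Measurable (steadyState s α) := by
    unfold steadyState
    fun_prop
  refine memLp_top_of_bound (by fun_prop) ((|psi0 α| * (1 + 2 * (Real.cosh α + 1))) ^ 2)
    (Eventually.of_forall fun x => ?_)
  rw [Complex.norm_real, Real.norm_eq_abs, abs_pow]
  exact pow_le_pow_left₀ (abs_nonneg _) (abs_steadyState_le s α x) 2

/-! ### The linearized operator -/

/-- The complex Hilbert space `L²(ℝ)`. -/
abbrev L2 : Type := Lp ℂ 2 (volume : Measure ℝ)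

/-- The complex Hilbert space `L²(ℝ) × L²(ℝ)`. -/
abbrev L2Pair : Type := WithLp 2 (L2 × L2)

/-- The Sobolev space `H²(ℝ)`, as a subspace of `L²(ℝ)`. -/
def sobolevH2 : Submodule ℂ L2 where
  carrier := {f | TemperedDistribution.MemSobolev 2 2 (f : 𝓢'(ℝ, ℂ))}
  add_mem' {f g} hf hg := by
    have h := TemperedDistribution.MemSobolev.add hf hg
    simpa only [Set.mem_ofPred_eq, ← Lp.toTemperedDistributionCLM_apply, map_add] using h
  zero_mem' := by
    have h := TemperedDistribution.memSobolev_fun_zero ℝ ℂ 2 2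
    simpa only [Set.mem_ofPred_eq, ← Lp.toTemperedDistributionCLM_apply, map_zero] using h
  smul_mem' c f hf := by
    have h := TemperedDistribution.MemSobolev.smul c hf
    simpa only [Set.mem_ofPred_eq, ← Lp.toTemperedDistributionCLM_apply, map_smul] using h

/-- The distributional second derivative of an `H²` function is an `L²` function. -/
theorem exists_secondDeriv (f : sobolevH2) :
    ∃ g : L2, (g : 𝓢'(ℝ, ℂ)) = ∂_{(1 : ℝ)} (∂_{(1 : ℝ)} ((f : L2) : 𝓢'(ℝ, ℂ))) := by
  have hf : TemperedDistribution.MemSobolev 2 2 ((f : L2) : 𝓢'(ℝ, ℂ)) := f.2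
  have h := (hf.lineDerivOp (m := (1 : ℝ))).lineDerivOp (m := (1 : ℝ))
  have h0 : (2 : ℝ) - 1 - 1 = 0 := by norm_num
  rw [h0, TemperedDistribution.memSobolev_zero_iff] at h
  obtain ⟨g, hg⟩ := h
  exact ⟨g, hg.symm⟩

theorem toTemperedDistribution_injective {f g : L2}
    (h : (f : 𝓢'(ℝ, ℂ)) = (g : 𝓢'(ℝ, ℂ))) : f = g := by
  have hk := Lp.ker_toTemperedDistributionCLM_eq_bot (E := ℝ) (F := ℂ) (μ := volume) (p := 2)
  exact LinearMap.ker_eq_bot.1 hk h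

/-- The operator `∂ₓₓ : H²(ℝ) → L²(ℝ)`, the second derivative in the sense of distributions. -/
def secondDeriv : sobolevH2 →ₗ[ℂ] L2 where
  toFun f := (exists_secondDeriv f).choose
  map_add' f g := by
    apply toTemperedDistribution_injective
    rw [(exists_secondDeriv (f + g)).choose_spec]
    simp only [← Lp.toTemperedDistributionCLM_apply, map_add]
    simp only [Lp.toTemperedDistributionCLM_apply, (exists_secondDeriv _).choose_spec]
    simp only [← Lp.toTemperedDistributionCLM_apply, Submodule.coe_add, map_add,
      LineDeriv.lineDerivOp_add]
  map_smul' c f := by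
    apply toTemperedDistribution_injective
    rw [(exists_secondDeriv (c • f)).choose_spec]
    simp only [← Lp.toTemperedDistributionCLM_apply, map_smul, RingHom.id_apply]
    simp only [Lp.toTemperedDistributionCLM_apply, (exists_secondDeriv _).choose_spec]
    simp only [← Lp.toTemperedDistributionCLM_apply, Submodule.coe_smul, map_smul,
      LineDeriv.lineDerivOp_smul]

theorem secondDeriv_spec (f : sobolevH2) :
    (secondDeriv f : 𝓢'(ℝ, ℂ)) = ∂_{(1 : ℝ)} (∂_{(1 : ℝ)} ((f : L2) : 𝓢'(ℝ, ℂ))) :=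
  (exists_secondDeriv f).choose_spec

/-- Multiplication by the function `u_s ^ 2` on `L²(ℝ)`. -/
def mulSq (s : ℤˣ) (α : ℝ) : L2 →ₗ[ℂ] L2 where
  toFun f := (memLp_steadyState_sq s α).toLp _ • f
  map_add' _ _ := Lp.add_smul _ _ _
  map_smul' _ _ := (Lp.smul_comm _ _ _).symm

theorem coeFn_mulSq (s : ℤˣ) (α : ℝ) (f : L2) :
    mulSq s α f =ᵐ[volume] fun x => ((steadyState s α x ^ 2 : ℝ) : ℂ) * f x := by
  have h1 := Lp.coeFn_lpSMul (r := 2) ((memLp_steadyState_sq s α).toLp _) f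
  filter_upwards [h1, (memLp_steadyState_sq s α).coeFn_toLp] with x hx h2
  have hx' : mulSq s α f x = _ := hx
  rw [hx', Pi.smul_apply', h2, smul_eq_mul]

/-- The Schrödinger operator `-∂ₓₓ + 1 - c u_s²` on `H²(ℝ)`. -/
def schrodinger (c : ℂ) (s : ℤˣ) (α : ℝ) : sobolevH2 →ₗ[ℂ] L2 :=
  -secondDeriv + sobolevH2.subtype - c • (mulSq s α ∘ₗ sobolevH2.subtype)

/-- `L₊ = -∂ₓₓ + 1 - 6 u_s²`. -/
def Lplus (s : ℤˣ) (α : ℝ) : sobolevH2 →ₗ[ℂ] L2 := schrodinger 6 s α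

/-- `L₋ = -∂ₓₓ + 1 - 2 u_s²`. -/
def Lminus (s : ℤˣ) (α : ℝ) : sobolevH2 →ₗ[ℂ] L2 := schrodinger 2 s α

/-- `H²(ℝ) × H²(ℝ)`, as a subspace of `L²(ℝ) × L²(ℝ)`. -/
def sobolevH2Pair : Submodule ℂ L2Pair :=
  sobolevH2.comap (WithLp.fstₗ 2 ℂ L2 L2) ⊓ sobolevH2.comap (WithLp.sndₗ 2 ℂ L2 L2)

/-- The diagonal operator `𝓛 (y₁, y₂) = (L₊ y₁, L₋ y₂)` on `L²(ℝ) × L²(ℝ)`, with domain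
`H²(ℝ) × H²(ℝ)`. -/
def opL (s : ℤˣ) (α : ℝ) : L2Pair →ₗ.[ℂ] L2Pair where
  domain := sobolevH2Pair
  toFun :=
    { toFun := fun y => WithLp.toLp 2
        (Lplus s α ⟨(y : L2Pair).fst, y.2.1⟩, Lminus s α ⟨(y : L2Pair).snd, y.2.2⟩)
      map_add' := fun y z => by
        rw [← WithLp.toLp_add, Prod.mk_add_mk, ← map_add, ← map_add]
        rfl
      map_smul' := fun c y => by
        rw [RingHom.id_apply, ← WithLp.toLp_smul, Prod.smul_mk, ← map_smul, ← map_smul]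
        rfl }

/-- The skew-symmetric matrix operator `𝓙 (y₁, y₂) = (y₂, -y₁)`. -/
def opJ : L2Pair →ₗ[ℂ] L2Pair where
  toFun y := WithLp.toLp 2 (y.snd, -y.fst)
  map_add' y z := by
    apply WithLp.ofLp_injective 2
    refine Prod.ext rfl ?_
    exact neg_add y.fst z.fst
  map_smul' c y := by
    apply WithLp.ofLp_injective 2
    refine Prod.ext rfl ?_
    exact (smul_neg c y.fst).symm

/-- The linearized operator `𝓙𝓛` about the steady state `u_s`. -/
def opJL (s : ℤˣ) (α : ℝ) : L2Pair →ₗ.[ℂ] L2Pair := opJ.compPMap (opL s α)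

end LugiatoLefever

end

/-! Write `a = 1 - 6ψ₀²` and `b = 1 - 2ψ₀²`. Since `u² → ψ₀²` at infinity, `𝓙𝓛` is a constant
coefficient operator plus multiplication by decaying functions. With `k = 2πξ`, the symbol of the
constant coefficient operator minus `z` has determinant `z² + (k² + a)(k² + b)`. It vanishes for
some real `ξ` exactly when `z` lies on the rays `iλ`, `|λ| ≥ √(ab)`, and `a > 0` because `cosh α >
1`.

Unboundedness is removed by parametrising `H² × H²` by `L² × L²` through the Bessel potential `G =
(1 - (2π)⁻²∂ₓₓ)⁻¹` (`isPencil_opJL`). Then `𝓙𝓛 - z` turns into the bounded operator `freePencil a b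
z + V G`, where `V` is multiplication by the decaying part. The product `V G` has a square
integrable kernel, hence is a norm limit of finite rank operators (`mulCLM_comp_multiplier_mem`).

On the rays: if `z` were in the resolvent set, subtracting `V G` would make the free pencil Fredholm
of index zero. It is injective, as its determinant vanishes only on a null set, so it would be
invertible by the Fredholm alternative; wave packets concentrated at a zero of the determinant
exclude this.

Off the rays: the free pencil is invertible, so the full pencil is Fredholm of index zero throughout
the complement, which is connected. For large real `w` the free resolvent is small and a Neumann
series gives a resolvent point. The analytic Fredholm alternative
(`IsUnitAddFiniteRank.eventually_isUnit`) then makes every remaining spectral point isolated with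
finite ascent, and the kernel and range of a power of the pencil supply the root space and its
invariant complement.

Finally, the rays have no isolated points, so none of their points is a discrete eigenvalue. -/

/-! ### Finite rank perturbations of invertible operators -/

namespace UnboundedOperator

section FiniteRank

variable {E F G : Type*} [NormedAddCommGroup E] [NormedSpace ℂ E] [NormedAddCommGroup F]
  [NormedSpace ℂ F] [NormedAddCommGroup G] [NormedSpace ℂ G]

/-- The bounded operators of finite rank. -/
def finiteRank (E F : Type*) [NormedAddCommGroup E] [NormedSpace ℂ E] [NormedAddCommGroup F]
    [NormedSpace ℂ F] : Submodule ℂ (E →L[ℂ] F) where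
  carrier := {T | FiniteDimensional ℂ (T : E →ₗ[ℂ] F).range}
  add_mem' {S T} hS hT := by
    have : FiniteDimensional ℂ (S : E →ₗ[ℂ] F).range := hS
    have : FiniteDimensional ℂ (T : E →ₗ[ℂ] F).range := hT
    exact Submodule.finiteDimensional_of_le (LinearMap.range_add_le (S : E →ₗ[ℂ] F) T)
  zero_mem' := by
    change FiniteDimensional ℂ (0 : E →ₗ[ℂ] F).range
    rw [LinearMap.range_zero]
    infer_instance
  smul_mem' c T hT := by
    have : FiniteDimensional ℂ (T : E →ₗ[ℂ] F).range := hT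
    refine Submodule.finiteDimensional_of_le (S₂ := (T : E →ₗ[ℂ] F).range) ?_
    rintro _ ⟨x, rfl⟩
    exact ⟨c • x, by simp⟩

theorem mem_finiteRank {T : E →L[ℂ] F} :
    T ∈ finiteRank E F ↔ FiniteDimensional ℂ (T : E →ₗ[ℂ] F).range := Iff.rfl

theorem comp_mem_finiteRank (S : F →L[ℂ] G) {T : E →L[ℂ] F} (hT : T ∈ finiteRank E F) :
    S ∘L T ∈ finiteRank E G := by
  rw [mem_finiteRank] at hT ⊢
  rw [ContinuousLinearMap.toLinearMap_comp, LinearMap.range_comp]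
  infer_instance

theorem mem_finiteRank_comp {S : F →L[ℂ] G} (hS : S ∈ finiteRank F G) (T : E →L[ℂ] F) :
    S ∘L T ∈ finiteRank E G := by
  rw [mem_finiteRank] at hS ⊢
  rw [ContinuousLinearMap.toLinearMap_comp]
  exact Submodule.finiteDimensional_of_le (LinearMap.range_comp_le_range _ _)

/-- The norm closure of the operators of finite rank. -/
noncomputable def approxFiniteRank (E F : Type*) [NormedAddCommGroup E] [NormedSpace ℂ E]
    [NormedAddCommGroup F] [NormedSpace ℂ F] : Submodule ℂ (E →L[ℂ] F) :=
  (finiteRank E F).topologicalClosure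

theorem comp_mem_approxFiniteRank (S : F →L[ℂ] G) {T : E →L[ℂ] F}
    (hT : T ∈ approxFiniteRank E F) : S ∘L T ∈ approxFiniteRank E G :=
  map_mem_closure (ContinuousLinearMap.compL ℂ E F G S).continuous hT
    fun _ h => comp_mem_finiteRank S h

theorem mem_approxFiniteRank_comp {S : F →L[ℂ] G} (hS : S ∈ approxFiniteRank F G)
    (T : E →L[ℂ] F) : S ∘L T ∈ approxFiniteRank E G :=
  map_mem_closure (f := fun S : F →L[ℂ] G => S ∘L T)
    ((ContinuousLinearMap.compL ℂ E F G).flip T).continuous hS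
    fun _ h => mem_finiteRank_comp h T

end FiniteRank

variable {H : Type*} [NormedAddCommGroup H] [NormedSpace ℂ H]

/-- An operator is the sum of an invertible operator and an operator of finite rank, that is, a
Fredholm operator of index zero. -/
def IsUnitAddFiniteRank (X : H →L[ℂ] H) : Prop :=
  ∃ U F : H →L[ℂ] H, IsUnit U ∧ F ∈ finiteRank H H ∧ X = U + F

theorem IsUnitAddFiniteRank.mul {X Y : H →L[ℂ] H} (hX : IsUnitAddFiniteRank X)
    (hY : IsUnitAddFiniteRank Y) : IsUnitAddFiniteRank (X * Y) := by
  obtain ⟨U, F, hU, hF, rfl⟩ := hX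
  obtain ⟨U', F', hU', hF', rfl⟩ := hY
  refine ⟨U * U', U * F' + F * (U' + F'), hU.mul hU', ?_, by noncomm_ring⟩
  exact (finiteRank H H).add_mem (comp_mem_finiteRank _ hF') (mem_finiteRank_comp hF _)

theorem IsUnitAddFiniteRank.of_isUnit {X : H →L[ℂ] H} (hX : IsUnit X) : IsUnitAddFiniteRank X :=
  ⟨X, 0, hX, zero_mem _, (add_zero X).symm⟩

theorem IsUnitAddFiniteRank.pow {X : H →L[ℂ] H} (hX : IsUnitAddFiniteRank X) (n : ℕ) :
    IsUnitAddFiniteRank (X ^ n) := by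
  induction n with
  | zero => rw [pow_zero]; exact .of_isUnit isUnit_one
  | succ n ih => rw [pow_succ]; exact ih.mul hX

theorem IsUnitAddFiniteRank.add {X F : H →L[ℂ] H} (hX : IsUnitAddFiniteRank X)
    (hF : F ∈ finiteRank H H) : IsUnitAddFiniteRank (X + F) := by
  obtain ⟨U, F', hU, hF', rfl⟩ := hX
  exact ⟨U, F' + F, hU, add_mem hF' hF, add_assoc _ _ _⟩

/-- If `U x + F x = 0`, then `x = -U⁻¹ F x` lies in the finite-dimensional range of `U⁻¹ F`. -/
theorem IsUnitAddFiniteRank.finiteDimensional_ker {X : H →L[ℂ] H} (hX : IsUnitAddFiniteRank X) :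
    FiniteDimensional ℂ (X : H →ₗ[ℂ] H).ker := by
  obtain ⟨U, F, hU, hF, rfl⟩ := hX
  obtain ⟨U, rfl⟩ := hU
  have : FiniteDimensional ℂ (((↑U⁻¹ : H →L[ℂ] H) ∘L F : H →L[ℂ] H) : H →ₗ[ℂ] H).range :=
    comp_mem_finiteRank _ hF
  refine Submodule.finiteDimensional_of_le
    (S₂ := (((↑U⁻¹ : H →L[ℂ] H) ∘L F : H →L[ℂ] H) : H →ₗ[ℂ] H).range) fun x hx => ⟨-x, ?_⟩
  have hx' : (↑U : H →L[ℂ] H) x + F x = 0 := hx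
  have hUU : (↑U⁻¹ : H →L[ℂ] H) ((↑U : H →L[ℂ] H) x) = x := by
    rw [← mul_apply_eq_comp, U.inv_mul]; rfl
  have : F (-x) = (↑U : H →L[ℂ] H) x := by
    rw [map_neg, ← eq_neg_of_add_eq_zero_left hx']
  simp [this, hUU]

variable [CompleteSpace H]

/-- Units are open: for `F` of finite rank close enough to `T`, the operator `U + T - F` is still
invertible, and `F` is the finite rank remainder. -/
theorem IsUnitAddFiniteRank.of_isUnit_add {U T : H →L[ℂ] H} (hU : IsUnit U)
    (hT : T ∈ approxFiniteRank H H) : IsUnitAddFiniteRank (U + T) := by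
  have ho : IsOpen {Y : H →L[ℂ] H | IsUnit (U + T - Y)} :=
    Units.isOpen.preimage (continuous_const.sub continuous_id)
  have hm : T ∈ {Y : H →L[ℂ] H | IsUnit (U + T - Y)} := by simpa using hU
  obtain ⟨F, hF, hF'⟩ := mem_closure_iff.1 hT _ ho hm
  exact ⟨_, F, hF, hF', (sub_add_cancel _ _).symm⟩

/-- The Fredholm alternative. -/
theorem IsUnitAddFiniteRank.isUnit_of_injective {X : H →L[ℂ] H} (hX : IsUnitAddFiniteRank X)
    (hi : Function.Injective X) : IsUnit X := by
  obtain ⟨U, F, hU, hF, rfl⟩ := hX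
  obtain ⟨U, rfl⟩ := hU
  rw [ContinuousLinearMap.isUnit_iff_bijective]
  refine ⟨hi, fun y => ?_⟩
  set P : H →L[ℂ] H := (↑U⁻¹ : H →L[ℂ] H) * F with hP
  have hUU : ∀ x, (↑U⁻¹ : H →L[ℂ] H) ((↑U : H →L[ℂ] H) x) = x := fun x => by
    rw [← mul_apply_eq_comp, U.inv_mul]; rfl
  have hUU' : ∀ x, (↑U : H →L[ℂ] H) ((↑U⁻¹ : H →L[ℂ] H) x) = x := fun x => by
    rw [← mul_apply_eq_comp, U.mul_inv]; rfl
  have hfin : FiniteDimensional ℂ (P : H →ₗ[ℂ] H).range := comp_mem_finiteRank _ hF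
  -- `1 + P = U⁻¹(U + F)` maps the finite-dimensional range of `P` into itself, where injectivity
  -- gives surjectivity. Solving `w + P w = P U⁻¹ y` there makes `U⁻¹ y - w` a preimage of `y`.
  let W := (P : H →ₗ[ℂ] H).range
  let g : W →ₗ[ℂ] W :=
    { toFun := fun w => ⟨w + P w, W.add_mem w.2 ⟨w, rfl⟩⟩
      map_add' := fun a b => by ext; simp; abel
      map_smul' := fun c a => by ext; simp }
  have hg : Function.Injective g := by
    intro a b hab
    have h1 : (a : H) + P a = b + P b := congrArg Subtype.val hab
    have h2 := congrArg (U : H →L[ℂ] H) h1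
    simp only [map_add, hP, mul_apply_eq_comp, hUU'] at h2
    exact Subtype.ext (hi h2)
  obtain ⟨w, hw⟩ := LinearMap.surjective_of_injective hg ⟨P ((↑U⁻¹ : H →L[ℂ] H) y), ⟨_, rfl⟩⟩
  have hw' : (w : H) + P w = P ((↑U⁻¹ : H →L[ℂ] H) y) := congrArg Subtype.val hw
  have h2 := congrArg (U : H →L[ℂ] H) hw'
  simp only [map_add, hP, mul_apply_eq_comp, hUU'] at h2
  refine ⟨(↑U⁻¹ : H →L[ℂ] H) y - w, ?_⟩
  rw [map_sub, add_apply, add_apply, h2, hUU', add_sub_cancel_right]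

/-- If kernel and range of a Fredholm operator of index zero have trivial intersection, they are
complementary, and the range is closed. -/
theorem IsUnitAddFiniteRank.isCompl_ker_range {X : H →L[ℂ] H} (hX : IsUnitAddFiniteRank X)
    (h : ∀ x, X (X x) = 0 → X x = 0) :
    IsCompl (X : H →ₗ[ℂ] H).ker (X : H →ₗ[ℂ] H).range ∧
      IsClosed ((X : H →ₗ[ℂ] H).range : Set H) := by
  have := hX.finiteDimensional_ker
  obtain ⟨p, hp⟩ := Submodule.ClosedComplemented.of_finiteDimensional (X : H →ₗ[ℂ] H).ker
  let P : H →L[ℂ] H := (X : H →ₗ[ℂ] H).ker.subtypeL ∘L p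
  have hPm : ∀ x, X (P x) = 0 := fun x => (p x).2
  have hPk : ∀ x, X x = 0 → P x = x := fun x hx => congrArg Subtype.val (hp ⟨x, hx⟩)
  have hPF : P ∈ finiteRank H H := by
    refine Submodule.finiteDimensional_of_le (S₂ := (X : H →ₗ[ℂ] H).ker) ?_
    rintro _ ⟨x, rfl⟩
    exact (p x).2
  -- `P` projects onto the kernel. If `X x + P x = 0`, applying `X` gives `X² x = 0`, so `X x = 0`
  -- by hypothesis, and then `x = P x = 0`.
  have hu : IsUnit (X + P) := by
    refine (hX.add hPF).isUnit_of_injective ((injective_iff_map_eq_zero _).2 fun x hx => ?_)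
    rw [add_apply] at hx
    have h1 : X x = 0 := h x (by
      have := congrArg X hx
      rwa [map_add, hPm, add_zero, map_zero] at this)
    rw [h1, zero_add, hPk x h1] at hx
    exact hx
  have hbij := ContinuousLinearMap.isUnit_iff_bijective.1 hu
  refine ⟨⟨?_, ?_⟩, ?_⟩
  · rw [Submodule.disjoint_def]
    rintro _ hx ⟨y, rfl⟩
    exact h y hx
  · rw [codisjoint_iff, eq_top_iff]
    intro y _
    obtain ⟨x, rfl⟩ := hbij.2 y
    rw [add_apply, add_comm]
    exact Submodule.add_mem_sup (hPm x) ⟨x, rfl⟩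
  · obtain ⟨u, hu'⟩ := hu
    -- `X x = (X + P)(x - P x)`, so the range of `X` is the image of `ker P` under an invertible
    -- operator.
    have heq : ((X : H →ₗ[ℂ] H).range : Set H) = {y | P ((↑u⁻¹ : H →L[ℂ] H) y) = 0} := by
      ext y
      have hinv : ∀ x, (↑u⁻¹ : H →L[ℂ] H) ((X + P) x) = x := fun x => by
        rw [← hu', ← mul_apply_eq_comp, u.inv_mul]; rfl
      constructor
      · rintro ⟨x, rfl⟩
        have h1 : X x = (X + P) (x - P x) := by
          rw [add_apply, map_sub, map_sub, hPm, hPk (P x) (hPm x)]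
          simp
        change P ((↑u⁻¹ : H →L[ℂ] H) (X x)) = 0
        rw [h1, hinv, map_sub, hPk (P x) (hPm x), sub_self]
      · intro hy
        obtain ⟨x, rfl⟩ := hbij.2 y
        have hy' : P x = 0 := by rw [← hinv x]; exact hy
        exact ⟨x, by simp [hy']⟩
    rw [heq]
    exact isClosed_singleton.preimage (P.continuous.comp (↑u⁻¹ : H →L[ℂ] H).continuous)

/-- Along a line through a Fredholm operator of index zero, the inverse is locally the quotient of
an operator-valued function by a scalar analytic function. -/
theorem IsUnitAddFiniteRank.exists_cofactor {X : H →L[ℂ] H} (hX : IsUnitAddFiniteRank X)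
    (K : H →L[ℂ] H) :
    ∃ (d : ℂ → ℂ) (Y : ℂ → H →L[ℂ] H), AnalyticAt ℂ d 0 ∧ ContinuousAt Y 0 ∧
      ∀ᶠ t in 𝓝 0, Y t * (X - t • K) = d t • 1 ∧ (X - t • K) * Y t = d t • 1 ∧
        (d t = 0 → ¬IsUnit (X - t • K)) := by
  obtain ⟨U, F, hU, hF, rfl⟩ := hX
  rw [mem_finiteRank] at hF
  let n := Module.finrank ℂ (F : H →ₗ[ℂ] H).range
  let e : (F : H →ₗ[ℂ] H).range ≃L[ℂ] (Fin n → ℂ) := ContinuousLinearEquiv.ofFinrankEq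
    (by simp [n])
  let φ : H →L[ℂ] (Fin n → ℂ) :=
    (e : (F : H →ₗ[ℂ] H).range →L[ℂ] (Fin n → ℂ)) ∘L
      F.codRestrict (F : H →ₗ[ℂ] H).range fun x => LinearMap.mem_range_self _ x
  let ι : (Fin n → ℂ) →L[ℂ] H := (F : H →ₗ[ℂ] H).range.subtypeL ∘L e.symm
  have hιφ : ∀ x, F x = ι (φ x) := fun x =>
    (congrArg Subtype.val (e.symm_apply_apply ⟨F x, LinearMap.mem_range_self _ x⟩)).symm
  let I : ℂ → H →L[ℂ] H := fun t => Ring.inverse (U - t • K)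
  have hI : AnalyticAt ℂ I 0 := by
    obtain ⟨u, rfl⟩ := hU
    have h1 : AnalyticAt ℂ (fun t : ℂ => (u : H →L[ℂ] H) - t • K) 0 := by fun_prop
    have h2 := analyticAt_inverse (𝕜 := ℂ) u
    exact AnalyticAt.fun_comp (g := Ring.inverse) (by simpa using h2) h1
  -- Factor `F = ι φ` through `ℂⁿ`. Invertibility of `U - tK + ι φ` reduces to that of the matrix `1
  -- + φ (U - tK)⁻¹ ι`, whose determinant is the scalar `d`.
  let M : ℂ → Matrix (Fin n) (Fin n) ℂ := fun t => 1 + LinearMap.toMatrix' (φ ∘L I t ∘L ι : _ →L[ℂ] _)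
  have hMan : ∀ i j, AnalyticAt ℂ (fun t => M t i j) 0 := by
    intro i j
    let ℓ : (H →L[ℂ] H) →L[ℂ] ℂ := (ContinuousLinearMap.proj (R := ℂ) (φ := fun _ : Fin n => ℂ) i) ∘L φ ∘L
      (ContinuousLinearMap.apply ℂ H (ι (Pi.single j 1)))
    have : (fun t => M t i j) = fun t => (1 : Matrix (Fin n) (Fin n) ℂ) i j + ℓ (I t) := by
      funext t
      simp [M, ℓ, LinearMap.toMatrix'_apply, Matrix.add_apply]
    rw [this]
    exact analyticAt_const.add ((ℓ.analyticAt _).comp hI)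
  let d : ℂ → ℂ := fun t => (M t).det
  have hd : AnalyticAt ℂ d 0 := by
    simp only [d, Matrix.det_apply]
    refine Finset.analyticAt_fun_sum _ fun σ _ => ?_
    exact AnalyticAt.const_smul (Finset.analyticAt_fun_prod _ fun i _ => hMan _ _)
  have hMc : ContinuousAt M 0 :=
    continuousAt_pi.2 fun i => continuousAt_pi.2 fun j => (hMan i j).continuousAt
  let Λ : Matrix (Fin n) (Fin n) ℂ →ₗ[ℂ] ((Fin n → ℂ) →L[ℂ] (Fin n → ℂ)) :=
    LinearMap.toContinuousLinearMap.toLinearMap ∘ₗ Matrix.toLin'.toLinearMap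
  have hΛ : Continuous Λ := Λ.continuous_of_finiteDimensional
  have hΛm : ∀ (A : Matrix (Fin n) (Fin n) ℂ) c, Λ A c = A.mulVec c := fun A c => rfl
  let Q : ℂ → (Fin n → ℂ) →L[ℂ] (Fin n → ℂ) := fun t => Λ (M t).adjugate
  have hQ : ContinuousAt Q 0 :=
    hΛ.continuousAt.comp ((Continuous.matrix_adjugate continuous_id).continuousAt.comp hMc)
  have hM1 : ∀ t c, (M t).mulVec c = c + φ (I t (ι c)) := by
    intro t c
    rw [Matrix.add_mulVec, Matrix.one_mulVec, LinearMap.toMatrix'_mulVec]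
    rfl
  have hQ1 : ∀ t c, Q t (c + φ (I t (ι c))) = d t • c := by
    intro t c
    rw [← hM1, hΛm, Matrix.mulVec_mulVec, Matrix.adjugate_mul, Matrix.smul_mulVec, Matrix.one_mulVec]
  have hQ2 : ∀ t c, Q t c + φ (I t (ι (Q t c))) = d t • c := by
    intro t c
    rw [← hM1, hΛm, Matrix.mulVec_mulVec, Matrix.mul_adjugate, Matrix.smul_mulVec, Matrix.one_mulVec]
  -- The Woodbury formula for the inverse, multiplied by `d`: the adjugate `Q` replaces `M⁻¹`, so
  -- the expression makes sense also where `d` vanishes.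
  refine ⟨d, fun t => d t • I t - I t ∘L ι ∘L Q t ∘L φ ∘L I t, hd, ?_, ?_⟩
  · have h1 := hd.continuousAt
    have h2 := hI.continuousAt
    exact (h1.smul h2).sub (h2.clm_comp (continuousAt_const.clm_comp
      (hQ.clm_comp (continuousAt_const.clm_comp h2))))
  · have hopen : ∀ᶠ t in 𝓝 (0 : ℂ), IsUnit (U - t • K) := by
      have hc : Continuous fun t : ℂ => U - t • K := by fun_prop
      exact hc.continuousAt.eventually (Units.isOpen.mem_nhds (by simpa using hU))
    filter_upwards [hopen] with t ht
    have hL : ∀ x, I t (U x - t • K x) = x := fun x => by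
      have := Ring.inverse_mul_cancel _ ht
      exact congrArg (fun Z : H →L[ℂ] H => Z x) this
    have hR : ∀ x, U (I t x) - t • K (I t x) = x := fun x => by
      have := Ring.mul_inverse_cancel _ ht
      exact congrArg (fun Z : H →L[ℂ] H => Z x) this
    have hXa : ∀ x, (U + F - t • K) x = (U x - t • K x) + ι (φ x) := fun x => by
      simp only [sub_apply, add_apply, smul_apply, hιφ]
      abel
    refine ⟨?_, ?_, ?_⟩
    · ext x
      simp only [mul_apply_eq_comp, hXa, sub_apply, smul_apply,
        ContinuousLinearMap.comp_apply, one_apply_eq_self]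
      rw [map_add (I t), hL, map_add φ, hQ1, map_smul, map_smul, smul_add, add_sub_cancel_right]
    · ext x
      simp only [mul_apply_eq_comp, hXa, sub_apply, smul_apply,
        ContinuousLinearMap.comp_apply, one_apply_eq_self]
      have h1 : ∀ y, U (d t • I t x - I t y) - t • K (d t • I t x - I t y) = d t • x - y := by
        intro y
        trans d t • (U (I t x) - t • K (I t x)) - (U (I t y) - t • K (I t y))
        · simp only [map_sub, map_smul]
          module
        · rw [hR, hR]
      have h2 : φ (d t • I t x - I t (ι (Q t (φ (I t x))))) = Q t (φ (I t x)) := by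
        rw [map_sub, map_smul, ← hQ2 t (φ (I t x)), add_sub_cancel_right]
      rw [h1, h2, sub_add_cancel]
    · intro h0 hunit
      obtain ⟨c, hc, hc0⟩ := Matrix.exists_mulVec_eq_zero_iff.2 h0
      rw [hM1] at hc0
      have h1 : (U + F - t • K) (I t (ι c)) = 0 := by
        rw [hXa, hR, ← map_add, hc0, map_zero]
      have h2 : I t (ι c) = 0 := by
        have := (ContinuousLinearMap.isUnit_iff_bijective.1 hunit).1
        exact this (by rw [h1, map_zero])
      rw [h2, map_zero, add_zero] at hc0
      exact hc hc0

/-- The analytic Fredholm alternative along a line, with finite ascent at the base point. -/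
theorem IsUnitAddFiniteRank.eventually_isUnit {X K : H →L[ℂ] H} (hX : IsUnitAddFiniteRank X)
    (hXK : Commute X K) :
    (∀ᶠ t in 𝓝 (0 : ℂ), ¬IsUnit (X - t • K)) ∨
      ((∀ᶠ t in 𝓝[≠] (0 : ℂ), IsUnit (X - t • K)) ∧
        ∃ m : ℕ, ∀ x, (X ^ (m + 1)) x = 0 → (X ^ m) x = 0) := by
  obtain ⟨d, Y, hd, hY, h⟩ := hX.exists_cofactor K
  by_cases h0 : ∀ᶠ t in 𝓝 0, d t = 0
  · left
    filter_upwards [h0, h] with t h1 h2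
    exact h2.2.2 h1
  right
  constructor
  · rcases hd.eventually_eq_zero_or_eventually_ne_zero with h1 | h1
    · exact absurd h1 h0
    filter_upwards [h1, h.filter_mono nhdsWithin_le_nhds] with t h1 h2
    refine ⟨⟨X - t • K, (d t)⁻¹ • Y t, ?_, ?_⟩, rfl⟩
    · rw [mul_smul_comm, h2.2.1, smul_smul, inv_mul_cancel₀ h1, one_smul]
    · rw [smul_mul_assoc, h2.1, smul_smul, inv_mul_cancel₀ h1, one_smul]
  -- The ascent is bounded by the order `m` of the zero of `d` at `0`, where `d t = t ^ m g t` with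
  -- `g 0 ≠ 0`.
  · obtain ⟨m, g, hg, hg0, hgd⟩ := (hd.exists_eventuallyEq_pow_smul_nonzero_iff).2 h0
    refine ⟨m, fun x hx => ?_⟩
    -- `X ^ (m+1) - (tK) ^ (m+1) = (X - tK) P t` and `P 0 = X ^ m`. Apply `Y t` to this identity at
    -- `x`, cancel `t ^ m`, and let `t → 0`: the limit is `0 = g 0 • X ^ m x`.
    let P : ℂ → H →L[ℂ] H := fun t =>
      ∑ i ∈ Finset.range (m + 1), X ^ i * (t • K) ^ (m + 1 - 1 - i)
    have hPc : Continuous P := by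
      refine continuous_finsetSum _ fun i _ => ?_
      fun_prop
    have hP0 : P 0 = X ^ m := by
      simp only [P]
      rw [Finset.sum_range_succ, Finset.sum_eq_zero]
      · simp
      · intro i hi
        have : m - i ≠ 0 := by have := Finset.mem_range.1 hi; omega
        simp [this]
    have key : ∀ᶠ t in 𝓝[≠] (0 : ℂ),
        -(t • (Y t ((K ^ (m + 1)) x))) = g t • P t x := by
      filter_upwards [h.filter_mono nhdsWithin_le_nhds, hgd.filter_mono nhdsWithin_le_nhds,
        self_mem_nhdsWithin] with t h1 h2 h3
      have hcomm : Commute X (t • K) := hXK.smul_right t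
      have h4 := hcomm.mul_geom_sum₂ (m + 1)
      have h5 := congrArg (fun Z : H →L[ℂ] H => (Y t * Z) x) h4
      simp only [← mul_assoc, h1.1, mul_sub] at h5
      simp only [smul_mul_assoc, one_mul, smul_apply, sub_apply, mul_apply_eq_comp, hx,
        map_zero, zero_sub, smul_pow, map_smul, h2, sub_zero] at h5
      have h6 : t ^ m ≠ 0 := pow_ne_zero _ h3
      refine smul_right_injective H h6 ?_
      simp only [smul_neg, smul_smul, ← pow_succ]
      rw [← h5, smul_eq_mul]
      simp only [P, smul_pow]
    have hl1 : Tendsto (fun t => -(t • (Y t ((K ^ (m + 1)) x)))) (𝓝[≠] 0) (𝓝 0) := by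
      have : ContinuousAt (fun t => -(t • (Y t ((K ^ (m + 1)) x)))) 0 :=
        (continuousAt_id.smul (hY.clm_apply continuousAt_const)).neg
      have h2 := this.tendsto.mono_left (nhdsWithin_le_nhds (s := {0}ᶜ))
      simpa using h2
    have hl2 : Tendsto (fun t => g t • P t x) (𝓝[≠] 0) (𝓝 (g 0 • (X ^ m) x)) := by
      have : ContinuousAt (fun t => g t • P t x) 0 :=
        hg.continuousAt.smul (hPc.continuousAt.clm_apply continuousAt_const)
      rw [← hP0]
      exact this.tendsto.mono_left nhdsWithin_le_nhds
    have := tendsto_nhds_unique (hl1.congr' key) hl2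
    exact (smul_eq_zero.1 this.symm).resolve_left hg0

end UnboundedOperator

/-! ### Discrete spectrum of operators given by a pencil of bounded operators -/

namespace UnboundedOperator

variable {H : Type*} [NormedAddCommGroup H] [NormedSpace ℂ H]

/-- The unbounded operator `A` is `T G⁻¹` for bounded operators `G` and `T`, with `G` injective. -/
structure IsPencil (A : H →ₗ.[ℂ] H) (G T : H →L[ℂ] H) : Prop where
  injective : Function.Injective G
  mem_domain : ∀ h, G h ∈ A.domain
  exists_eq : ∀ x : A.domain, ∃ h, G h = x
  apply_eq : ∀ h, A ⟨G h, mem_domain h⟩ = T h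

namespace IsPencil

variable {A : H →ₗ.[ℂ] H} {G T : H →L[ℂ] H}

theorem shift_apply (hA : IsPencil A G T) (z : ℂ) (h : H) :
    shift A z ⟨G h, hA.mem_domain h⟩ = (T - z • G) h := by
  have := hA.apply_eq h
  change A ⟨G h, hA.mem_domain h⟩ - z • G h = T h - z • G h
  rw [this]

/-- A change of parametrisation of the domain; it allows normalising `T - w • G` to the identity, so
that `G` becomes the resolvent at `w`. -/
theorem mul_unit (hA : IsPencil A G T) (u : (H →L[ℂ] H)ˣ) : IsPencil A (G * u) (T * u) where
  injective := by
    refine hA.injective.comp (Function.LeftInverse.injective (g := (↑u⁻¹ : H →L[ℂ] H)) fun x => ?_)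
    exact congrArg (fun Z : H →L[ℂ] H => Z x) u.inv_mul
  mem_domain h := hA.mem_domain _
  exists_eq x := by
    obtain ⟨h, hh⟩ := hA.exists_eq x
    refine ⟨(↑u⁻¹ : H →L[ℂ] H) h, ?_⟩
    rw [← mul_apply_eq_comp, mul_assoc, u.mul_inv, mul_one, hh]
  apply_eq h := hA.apply_eq _

/-- `A - z = (T - zG) G⁻¹`, so the resolvent is `G (T - zG)⁻¹`; in the forward direction boundedness
of the inverse comes from the open mapping theorem. -/
theorem mem_resolventSet_iff [CompleteSpace H] (hA : IsPencil A G T) (z : ℂ) :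
    z ∈ resolventSet A ↔ IsUnit (T - z • G) := by
  constructor
  · rintro ⟨R, h1, h2⟩
    rw [ContinuousLinearMap.isUnit_iff_bijective]
    constructor
    · intro x y hxy
      have hx := h2 ⟨G x, hA.mem_domain x⟩
      have hy := h2 ⟨G y, hA.mem_domain y⟩
      rw [hA.shift_apply] at hx hy
      rw [hxy] at hx
      exact hA.injective (hx.symm.trans hy)
    · intro y
      obtain ⟨hy, hy'⟩ := h1 y
      obtain ⟨h, hh⟩ := hA.exists_eq ⟨R y, hy⟩
      refine ⟨h, ?_⟩
      rw [← hA.shift_apply, ← hy']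
      congr 2
  · rintro ⟨u, hu⟩
    refine ⟨G * ↑u⁻¹, fun y => ⟨hA.mem_domain _, ?_⟩, fun x => ?_⟩
    · refine (hA.shift_apply z _).trans ?_
      rw [← hu]
      exact congrArg (fun Z : H →L[ℂ] H => Z y) u.mul_inv
    · obtain ⟨h, hh⟩ := hA.exists_eq x
      have hx : x = ⟨G h, hA.mem_domain h⟩ := Subtype.ext hh.symm
      rw [hx, hA.shift_apply, ← hu, mul_apply_eq_comp, ← mul_apply_eq_comp (↑u⁻¹ : H →L[ℂ] H),
        u.inv_mul, one_apply_eq_self]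

variable {K : H →L[ℂ] H} {w z : ℂ}

/-- Here `K = (A - w)⁻¹`; this is the resolvent identity, which trades `A - z` for the bounded
operator `1 + (w - z)K`. -/
theorem apply_shift (hA : IsPencil A K (1 + w • K)) (z : ℂ) (x : A.domain) :
    K (shift A z x) = (1 + w • K - z • K) x := by
  obtain ⟨h, hh⟩ := hA.exists_eq x
  have hx : x = ⟨K h, hA.mem_domain h⟩ := Subtype.ext hh.symm
  subst hx
  rw [hA.shift_apply]
  simp

theorem commute_resolvent (w z : ℂ) (K : H →L[ℂ] H) : Commute (1 + w • K - z • K) K :=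
  ((Commute.one_left K).add_left ((Commute.refl K).smul_left w)).sub_left
    ((Commute.refl K).smul_left z)

theorem pow_apply_apply_eq_zero_iff (hA : IsPencil A K (1 + w • K)) (z : ℂ) (n : ℕ) (x : H) :
    ((1 + w • K - z • K) ^ n) (K x) = 0 ↔ ((1 + w • K - z • K) ^ n) x = 0 := by
  rw [← mul_apply_eq_comp, ((commute_resolvent w z K).pow_left n).eq, mul_apply_eq_comp]
  exact map_eq_zero_iff K hA.injective

/-- `K (A - z)` agrees with `1 + (w - z)K` on the domain, and `K` is injective and commutes with
that operator, so the powers have the same kernels. -/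
theorem kerPow_eq (hA : IsPencil A K (1 + w • K)) (z : ℂ) (n : ℕ) :
    kerPow A z n = (((1 + w • K - z • K) ^ n : H →L[ℂ] H) : H →ₗ[ℂ] H).ker := by
  have hker : ∀ (n : ℕ) (x : H), x ∈ (((1 + w • K - z • K) ^ n : H →L[ℂ] H) : H →ₗ[ℂ] H).ker ↔
    ((1 + w • K - z • K) ^ n) x = 0 := fun n x => Iff.rfl
  induction n with
  | zero =>
    ext x
    rw [hker, pow_zero, one_apply_eq_self]
    exact Submodule.mem_bot ℂ
  | succ n ih =>
    have hstep : ∀ x : A.domain, shift A z x ∈ kerPow A z n ↔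
        ((1 + w • K - z • K) ^ (n + 1)) x = 0 := fun x => by
      rw [ih, hker, ← hA.pow_apply_apply_eq_zero_iff, hA.apply_shift, pow_succ,
        mul_apply_eq_comp]
    ext x
    rw [hker]
    constructor
    · rintro ⟨y, hy, rfl⟩
      exact (hstep y).1 hy
    · intro hx
      have hd : x ∈ A.domain := by
        have h1 : (1 + w • K - z • K) x ∈ kerPow A z n := by
          rw [ih, hker, ← mul_apply_eq_comp, ← pow_succ, hx]
        have h2 : (1 + w • K - z • K) x ∈ A.domain := by
          cases n with
          | zero =>
            rw [(Submodule.mem_bot ℂ).1 h1]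
            exact zero_mem _
          | succ n =>
            obtain ⟨y, -, hy⟩ := h1
            rw [← hy]
            exact y.2
        -- Regularity of generalized eigenvectors: the first summand is in the domain by the
        -- inductive structure of `kerPow`, the second because it is in the range of `K`.
        have h3 : x = (1 + w • K - z • K) x + K ((z - w) • x) := by
          simp only [sub_apply, add_apply, smul_apply, one_apply_eq_self, map_smul]
          module
        rw [h3]
        exact add_mem h2 (hA.mem_domain _)
      exact ⟨⟨x, hd⟩, (hstep ⟨x, hd⟩).2 hx, rfl⟩

variable [CompleteSpace H]

/-- An isolated point of the spectrum at which a power of the Fredholm operator `A - z` has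
stationary kernel is a discrete eigenvalue. -/
theorem isDiscreteEigenvalue_of_ascent (hA : IsPencil A K (1 + w • K))
    (hX : IsUnitAddFiniteRank (1 + w • K - z • K)) (hs : ¬IsUnit (1 + w • K - z • K))
    (hiso : ∀ᶠ t in 𝓝[≠] z, t ∉ spectrum A) {m : ℕ}
    (hm : ∀ x, ((1 + w • K - z • K) ^ (m + 1)) x = 0 → ((1 + w • K - z • K) ^ m) x = 0) :
    IsDiscreteEigenvalue A z := by
  have hK := commute_resolvent w z K
  have hpow := hA.pow_apply_apply_eq_zero_iff z
  have hker := hA.kerPow_eq z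
  have hshift := hA.apply_shift z
  have hsh := hA.shift_apply z
  set X : H →L[ℂ] H := 1 + w • K - z • K with hXdef
  have hstab : ∀ n x, (X ^ n) x = 0 → (X ^ m) x = 0 := by
    have h1 : ∀ k x, (X ^ (m + k)) x = 0 → (X ^ m) x = 0 := by
      intro k
      induction k with
      | zero => exact fun x hx => hx
      | succ k ih =>
        intro x hx
        refine hm x ?_
        rw [pow_succ, mul_apply_eq_comp]
        refine ih _ ?_
        rw [← mul_apply_eq_comp, ← pow_succ]
        exact hx
    intro n x hx
    refine h1 n x ?_
    rw [pow_add, mul_apply_eq_comp, hx, map_zero]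
  have hroot : rootSubspace A z = ((X ^ m : H →L[ℂ] H) : H →ₗ[ℂ] H).ker := by
    refine le_antisymm (iSup_le fun n => ?_) ?_
    · rw [hker]
      exact fun x hx => hstab n x hx
    · rw [← hker]
      exact le_iSup (kerPow A z) m
  obtain ⟨hcompl, hclosed⟩ := (hX.pow m).isCompl_ker_range (by
    intro x hx
    rw [← mul_apply_eq_comp, ← pow_add] at hx
    exact hstab _ x hx)
  set N := ((X ^ m : H →L[ℂ] H) : H →ₗ[ℂ] H).ker
  set R := ((X ^ m : H →L[ℂ] H) : H →ₗ[ℂ] H).range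
  have hRK : ∀ x ∈ R, K x ∈ R := by
    rintro _ ⟨y, rfl⟩
    refine ⟨K y, ?_⟩
    change (X ^ m) (K y) = K ((X ^ m) y)
    rw [← mul_apply_eq_comp, (hK.pow_left m).eq, mul_apply_eq_comp]
  -- Split `x = a + b` along `N ⊕ R`. Both are `K`-invariant, so `K a` lies in `N ∩ R = 0` and `a =
  -- 0`. This is what transfers invariance of `R` from `X` to the unbounded `A`.
  have hKR : ∀ x, K x ∈ R → x ∈ R := by
    intro x hx
    obtain ⟨a, b, ha, hb, hab⟩ := Submodule.codisjoint_iff_exists_add_eq.1 hcompl.codisjoint x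
    have h1 : K a ∈ N := (hpow m a).2 ha
    have h2 : K a ∈ R := by
      have : K a = K x - K b := by rw [← hab, map_add, add_sub_cancel_right]
      rw [this]
      exact sub_mem hx (hRK b hb)
    have h3 : K a = 0 := Submodule.disjoint_def.1 hcompl.disjoint _ h1 h2
    have h4 : a = 0 := hA.injective (by rw [h3, map_zero])
    rw [← hab, h4, zero_add]
    exact hb
  have hXR : ∀ y ∈ R, ∃ r ∈ R, X r = y := by
    rintro _ ⟨v, rfl⟩
    obtain ⟨a, b, ha, hb, hab⟩ := Submodule.codisjoint_iff_exists_add_eq.1 hcompl.codisjoint v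
    obtain ⟨c, rfl⟩ := hb
    have ha' : (X ^ m) a = 0 := ha
    cases m with
    | zero =>
      -- For `m = 0` the hypothesis `hm` says that `X` is injective, hence invertible, against `hs`.
      refine absurd (hX.isUnit_of_injective ((injective_iff_map_eq_zero _).2 fun x hx => ?_)) hs
      simpa using hm x (by simpa using hx)
    | succ k =>
      refine ⟨(X ^ (k + 1)) ((X ^ k) c), ⟨_, rfl⟩, ?_⟩
      rw [← hab]
      change X ((X ^ (k + 1)) ((X ^ k) c)) = (X ^ (k + 1)) (a + (X ^ (k + 1)) c)
      rw [map_add, ha', zero_add]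
      simp only [← mul_apply_eq_comp, ← pow_add, ← pow_succ']
      congr 2
  refine ⟨hiso, ?_, ?_, ⟨R, hclosed, ?_, ?_, ?_⟩⟩
  · have hni : ¬Function.Injective X := fun h => hs (hX.isUnit_of_injective h)
    rw [injective_iff_map_eq_zero] at hni
    push Not at hni
    obtain ⟨x, hx, hx0⟩ := hni
    refine ⟨⟨K x, hA.mem_domain x⟩, ?_, ?_⟩
    · intro h
      exact hx0 (hA.injective (by rw [map_zero]; exact congrArg Subtype.val h))
    · have := hsh x
      rw [hx] at this
      exact sub_eq_zero.1 this
  · rw [hroot]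
    exact (hX.pow m).finiteDimensional_ker
  · rw [hroot]
    exact hcompl
  · intro x hx
    have h1 : shift A z x ∈ R := by
      refine hKR _ ?_
      rw [hshift]
      obtain ⟨y, hy⟩ := hx
      rw [← hy]
      refine ⟨X y, ?_⟩
      change (X ^ m) (X y) = X ((X ^ m) y)
      rw [← mul_apply_eq_comp, ← mul_apply_eq_comp, pow_mul_comm']
    have h2 : A x = shift A z x + z • (x : H) := (sub_add_cancel _ _).symm
    rw [h2]
    exact add_mem h1 (R.smul_mem z hx)
  · intro y hy
    obtain ⟨r, hr, rfl⟩ := hXR y hy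
    refine ⟨⟨K r, hA.mem_domain r⟩, ⟨hRK r hr, hsh r⟩, ?_⟩
    rintro x ⟨hx, hx'⟩
    have h1 : X (x - K r) = 0 := by
      rw [map_sub, ← hshift, hx', ← mul_apply_eq_comp, ← mul_apply_eq_comp, hK.eq, sub_self]
    have h2 : (x : H) - K r ∈ R := sub_mem hx (hRK r hr)
    have h3 : (x : H) - K r ∈ N := hstab 1 _ (by rwa [pow_one])
    exact Subtype.ext (sub_eq_zero.1 (Submodule.disjoint_def.1 hcompl.disjoint _ h3 h2))

/-- If `A - z` is Fredholm of index zero on a connected set containing a point of the resolvent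
set, then the spectrum in this set consists of discrete eigenvalues. -/
theorem isDiscreteEigenvalue (hA : IsPencil A G T) {Ω : Set ℂ} (hΩ : IsPreconnected Ω)
    (hfr : ∀ z ∈ Ω, IsUnitAddFiniteRank (T - z • G)) (hw : w ∈ Ω) (hwu : IsUnit (T - w • G))
    (hz : z ∈ Ω) (hs : z ∈ spectrum A) : IsDiscreteEigenvalue A z := by
  obtain ⟨u, hu⟩ := hwu
  set K : H →L[ℂ] H := G * ↑u⁻¹ with hKdef
  have hTu : T * ↑u⁻¹ = 1 + w • K := by
    have h1 : T = u + w • G := by rw [hu]; abel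
    rw [h1, add_mul, u.mul_inv, smul_mul_assoc]
  have hA' : IsPencil A K (1 + w • K) := hTu ▸ hA.mul_unit u⁻¹
  have hpen : ∀ ζ : ℂ, 1 + w • K - ζ • K = (T - ζ • G) * ↑u⁻¹ := fun ζ => by
    rw [← hTu, sub_mul, smul_mul_assoc]
  have hfr' : ∀ ζ ∈ Ω, IsUnitAddFiniteRank (1 + w • K - ζ • K) := fun ζ hζ => by
    rw [hpen]
    exact (hfr ζ hζ).mul (.of_isUnit u⁻¹.isUnit)
  have hres : ∀ ζ, ζ ∈ resolventSet A ↔ IsUnit (1 + w • K - ζ • K) := hA'.mem_resolventSet_iff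
  have htr : ∀ ζ t : ℂ, 1 + w • K - ζ • K - (t - ζ) • K = 1 + w • K - t • K := fun ζ t => by
    module
  have hsub : ∀ ζ : ℂ, Tendsto (fun t => t - ζ) (𝓝 ζ) (𝓝 0) := fun ζ => by
    have : Continuous fun t : ℂ => t - ζ := by fun_prop
    simpa using this.tendsto ζ
  have hsub' : ∀ ζ : ℂ, Tendsto (fun t => t - ζ) (𝓝[≠] ζ) (𝓝[≠] 0) := fun ζ => by
    refine tendsto_nhdsWithin_iff.2 ⟨(hsub ζ).mono_left nhdsWithin_le_nhds, ?_⟩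
    filter_upwards [self_mem_nhdsWithin] with t ht
    exact sub_ne_zero.2 ht
  have hdich : ∀ ζ ∈ Ω, (∀ᶠ t in 𝓝 ζ, t ∉ resolventSet A) ∨
      ((∀ᶠ t in 𝓝[≠] ζ, t ∈ resolventSet A) ∧ ∃ m : ℕ, ∀ x,
        ((1 + w • K - ζ • K) ^ (m + 1)) x = 0 → ((1 + w • K - ζ • K) ^ m) x = 0) := by
    intro ζ hζ
    refine ((hfr' ζ hζ).eventually_isUnit (commute_resolvent w ζ K)).imp (fun h => ?_)
      (And.imp_left fun h => ?_)
    · filter_upwards [(hsub ζ).eventually h] with t ht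
      rwa [hres, ← htr ζ t]
    · filter_upwards [(hsub' ζ).eventually h] with t ht
      rwa [hres, ← htr ζ t]
  -- `Ω` is covered by two open sets, disjoint on `Ω`: points with a neighbourhood of spectrum, and
  -- points with a punctured neighbourhood in the resolvent set. The resolvent point `w` excludes
  -- the first.
  have hconn : Ω ⊆ {ζ | ∀ᶠ t in 𝓝[≠] ζ, t ∈ resolventSet A} := by
    have ho1 : IsOpen {ζ | ∀ᶠ t in 𝓝 ζ, t ∉ resolventSet A} := isOpen_setOfPred_eventually_nhds
    have ho2 : IsOpen {ζ | ∀ᶠ t in 𝓝[≠] ζ, t ∈ resolventSet A} :=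
      isOpen_setOfPred_eventually_nhdsWithin
    rcases isPreconnected_iff_subset_of_disjoint.1 hΩ _ _ ho1 ho2 (fun ζ hζ =>
      (hdich ζ hζ).imp id And.left) (by
        refine Set.eq_empty_of_forall_notMem fun ζ hζ => ?_
        have h1 : ∀ᶠ t in 𝓝[≠] ζ, t ∉ resolventSet A := hζ.2.1.filter_mono nhdsWithin_le_nhds
        exact (h1.and hζ.2.2).exists.elim fun t ht => ht.1 ht.2) with h | h
    · exfalso
      have h1 : w ∉ resolventSet A := (h hw).self_of_nhds
      exact h1 ((hres w).2 (by simp))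
    · exact h
  rcases hdich z hz with h | ⟨h, m, hm⟩
  · have h1 : ∀ᶠ t in 𝓝[≠] z, t ∉ resolventSet A := h.filter_mono nhdsWithin_le_nhds
    exact ((h1.and (hconn hz)).exists.elim fun t ht => ht.1 ht.2).elim
  · refine hA'.isDiscreteEigenvalue_of_ascent (hfr' z hz) (fun h => hs ((hres z).2 h)) ?_ hm
    filter_upwards [h] with t ht ht'
    exact ht' ht

end IsPencil

end UnboundedOperator

/-! ### Multiplication operators and Fourier multipliers on `L²(ℝ)` -/

noncomputable section

namespace LugiatoLefever

open scoped BoundedContinuousFunction FourierTransform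

theorem coeFn_toLp_smul (φ : ℝ →ᵇ ℂ) (f : L2) :
    ((φ.memLp_top.toLp φ : Lp ℂ ∞ (volume : Measure ℝ)) • f : L2) =ᵐ[volume]
      fun x => φ x * f x := by
  filter_upwards [Lp.coeFn_lpSMul (r := 2) (φ.memLp_top.toLp φ (μ := volume)) f,
    (φ.memLp_top (μ := (volume : Measure ℝ))).coeFn_toLp] with x hx h2
  rw [hx, Pi.smul_apply', h2, smul_eq_mul]

/-- Multiplication by a bounded continuous function on `L²(ℝ)`. -/
def mulCLM (φ : ℝ →ᵇ ℂ) : L2 →L[ℂ] L2 :=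
  LinearMap.mkContinuous
    { toFun := fun f => (φ.memLp_top.toLp φ : Lp ℂ ∞ (volume : Measure ℝ)) • f
      map_add' := fun _ _ => Lp.add_smul _ _ _
      map_smul' := fun _ _ => (Lp.smul_comm _ _ _).symm } ‖φ‖ fun f => by
    refine Lp.norm_le_mul_norm_of_ae_le_mul ?_
    filter_upwards [coeFn_toLp_smul φ f] with x hx
    refine (congrArg norm hx).le.trans ?_
    rw [norm_mul]
    exact mul_le_mul_of_nonneg_right (φ.norm_coe_le_norm x) (norm_nonneg _)

theorem coeFn_mulCLM (φ : ℝ →ᵇ ℂ) (f : L2) : mulCLM φ f =ᵐ[volume] fun x => φ x * f x :=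
  coeFn_toLp_smul φ f

theorem norm_mulCLM_le (φ : ℝ →ᵇ ℂ) : ‖mulCLM φ‖ ≤ ‖φ‖ :=
  LinearMap.mkContinuous_norm_le _ (norm_nonneg _) _

theorem mulCLM_mul (φ ψ : ℝ →ᵇ ℂ) : mulCLM (φ * ψ) = mulCLM φ * mulCLM ψ := by
  ext1 f
  refine Lp.ext ?_
  filter_upwards [coeFn_mulCLM (φ * ψ) f, coeFn_mulCLM φ (mulCLM ψ f), coeFn_mulCLM ψ f]
    with x h1 h2 h3
  rw [mul_apply_eq_comp, h1, h2, h3, BoundedContinuousFunction.mul_apply, mul_assoc]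

theorem mulCLM_add (φ ψ : ℝ →ᵇ ℂ) : mulCLM (φ + ψ) = mulCLM φ + mulCLM ψ := by
  ext1 f
  refine Lp.ext ?_
  filter_upwards [coeFn_mulCLM (φ + ψ) f, coeFn_mulCLM φ f, coeFn_mulCLM ψ f,
    Lp.coeFn_add (mulCLM φ f) (mulCLM ψ f)] with x h1 h2 h3 h4
  rw [add_apply, h4, Pi.add_apply, h1, h2, h3, BoundedContinuousFunction.add_apply, add_mul]

theorem mulCLM_algebraMap (c : ℂ) : mulCLM (algebraMap ℂ (ℝ →ᵇ ℂ) c) = c • 1 := by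
  ext1 f
  refine Lp.ext ?_
  filter_upwards [coeFn_mulCLM (algebraMap ℂ (ℝ →ᵇ ℂ) c) f, Lp.coeFn_smul c f] with x h1 h2
  rw [h1, smul_apply, one_apply_eq_self, h2, Pi.smul_apply, smul_eq_mul,
    BoundedContinuousFunction.algebraMap_apply, smul_eq_mul, mul_one]

/-- The Fourier transform on `L²(ℝ)`. -/
abbrev fourierL2 : L2 ≃ₗᵢ[ℂ] L2 := Lp.fourierTransformₗᵢ ℝ ℂ

/-- The Fourier multiplier with a bounded continuous symbol on `L²(ℝ)`. -/
def multiplier : (ℝ →ᵇ ℂ) →ₐ[ℂ] (L2 →L[ℂ] L2) where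
  toFun φ := fourierL2.symm.toContinuousLinearEquiv.toContinuousLinearMap ∘L mulCLM φ ∘L
    fourierL2.toContinuousLinearEquiv.toContinuousLinearMap
  map_one' := by
    ext1 f
    have := mulCLM_algebraMap 1
    rw [map_one, one_smul] at this
    simp [this]
  map_mul' φ ψ := by
    ext1 f
    simp [mulCLM_mul]
  map_zero' := by
    ext1 f
    have := mulCLM_algebraMap 0
    rw [map_zero, zero_smul] at this
    simp [this]
  map_add' φ ψ := by
    ext1 f
    simp [mulCLM_add]
  commutes' c := by
    ext1 f
    rw [mulCLM_algebraMap, Algebra.algebraMap_eq_smul_one]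
    simp

theorem multiplier_apply (φ : ℝ →ᵇ ℂ) (f : L2) :
    multiplier φ f = fourierL2.symm (mulCLM φ (fourierL2 f)) := rfl

theorem norm_multiplier_le (φ : ℝ →ᵇ ℂ) : ‖multiplier φ‖ ≤ ‖φ‖ := by
  refine ContinuousLinearMap.opNorm_le_bound _ (norm_nonneg _) fun f => ?_
  rw [multiplier_apply, LinearIsometryEquiv.norm_map, ← fourierL2.norm_map f]
  exact (mulCLM φ).le_of_opNorm_le (norm_mulCLM_le φ) _

theorem multiplier_injective {φ : ℝ →ᵇ ℂ} (hφ : ∀ᵐ x, φ x ≠ 0) :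
    Function.Injective (multiplier φ) := by
  refine (injective_iff_map_eq_zero _).2 fun f hf => ?_
  rw [multiplier_apply, LinearIsometryEquiv.map_eq_zero_iff] at hf
  rw [← fourierL2.map_eq_zero_iff]
  refine Lp.ext ?_
  filter_upwards [coeFn_mulCLM φ (fourierL2 f), Lp.coeFn_zero ℂ 2 (volume : Measure ℝ), hφ]
    with x h1 h2 h3
  rw [hf, h2] at h1
  rw [h2]
  exact (mul_eq_zero.1 h1.symm).resolve_left h3

/-! ### Bessel potentials as a parametrisation of the Sobolev space `H²(ℝ)` -/

/-- The symbol `(1 + ξ²)⁻¹`. -/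
def besselSymbol : ℝ →ᵇ ℂ :=
  BoundedContinuousFunction.ofNormedAddCommGroup (fun ξ : ℝ => (((1 + ξ ^ 2)⁻¹ : ℝ) : ℂ))
    (Complex.continuous_ofReal.comp (Continuous.inv₀ (by fun_prop) fun ξ => by positivity)) 1
    fun ξ => by
      rw [Complex.norm_real, Real.norm_of_nonneg (by positivity)]
      exact inv_le_one_of_one_le₀ (by nlinarith [sq_nonneg ξ])

theorem besselSymbol_apply (ξ : ℝ) : besselSymbol ξ = (((1 + ξ ^ 2)⁻¹ : ℝ) : ℂ) := rfl

/-- The symbol `4 π² ξ² (1 + ξ²)⁻¹`. -/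
def laplaceSymbol : ℝ →ᵇ ℂ := (((2 * Real.pi) ^ 2 : ℝ) : ℂ) • (1 - besselSymbol)

theorem laplaceSymbol_apply (ξ : ℝ) :
    laplaceSymbol ξ = (((2 * Real.pi * ξ) ^ 2 * (1 + ξ ^ 2)⁻¹ : ℝ) : ℂ) := by
  have h : (1 : ℝ) + ξ ^ 2 ≠ 0 := by positivity
  change (((2 * Real.pi) ^ 2 : ℝ) : ℂ) * (1 - (((1 + ξ ^ 2)⁻¹ : ℝ) : ℂ)) = _
  rw [← Complex.ofReal_one, ← Complex.ofReal_sub, ← Complex.ofReal_mul]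
  congr 1
  field_simp
  ring

theorem hasTemperateGrowth_besselSymbol : (besselSymbol : ℝ → ℂ).HasTemperateGrowth := by
  have h : (fun x : ℝ => (((1 + ‖x‖ ^ 2) ^ (-1 : ℝ) : ℝ) : ℂ)).HasTemperateGrowth := by fun_prop
  convert! h using 2 with x
  rw [besselSymbol_apply, Real.rpow_neg_one, Real.norm_eq_abs, sq_abs]

theorem hasTemperateGrowth_laplaceSymbol : (laplaceSymbol : ℝ → ℂ).HasTemperateGrowth := by
  have h : (fun x : ℝ => (((2 * Real.pi) ^ 2 : ℝ) : ℂ) * (1 - besselSymbol x)).HasTemperateGrowth :=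
    (Function.HasTemperateGrowth.const _).mul
      ((Function.HasTemperateGrowth.const _).sub hasTemperateGrowth_besselSymbol)
  exact h

theorem toTemperedDistribution_mulCLM {φ : ℝ →ᵇ ℂ} (hφ : (φ : ℝ → ℂ).HasTemperateGrowth) (f : L2) :
    (mulCLM φ f : 𝓢'(ℝ, ℂ)) = TemperedDistribution.smulLeftCLM ℂ φ (f : 𝓢'(ℝ, ℂ)) :=
  Lp.toTemperedDistribution_smul_eq hφ φ.memLp_top f

theorem fourier_toTemperedDistribution_multiplier {φ : ℝ →ᵇ ℂ}
    (hφ : (φ : ℝ → ℂ).HasTemperateGrowth) (f : L2) :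
    𝓕 (multiplier φ f : 𝓢'(ℝ, ℂ)) =
      TemperedDistribution.smulLeftCLM ℂ φ (fourierL2 f : 𝓢'(ℝ, ℂ)) := by
  rw [Lp.fourier_toTemperedDistribution_eq, ← toTemperedDistribution_mulCLM hφ]
  congr 1
  exact fourierL2.apply_symm_apply _

theorem bessel_rpow_mul (x : ℝ) :
    (((1 + ‖x‖ ^ 2) ^ ((2 : ℝ) / 2) : ℝ) : ℂ) * besselSymbol x = 1 := by
  have h : (1 : ℝ) + x ^ 2 ≠ 0 := by positivity
  rw [besselSymbol_apply, div_self two_ne_zero, Real.rpow_one, Real.norm_eq_abs, sq_abs,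
    ← Complex.ofReal_mul, mul_inv_cancel₀ h, Complex.ofReal_one]

theorem multiplier_besselSymbol_mem (h : L2) : multiplier besselSymbol h ∈ sobolevH2 := by
  refine TemperedDistribution.memSobolev_iff_exists_smulLeftCLM_fourier.2 ⟨fourierL2 h, ?_⟩
  rw [fourier_toTemperedDistribution_multiplier hasTemperateGrowth_besselSymbol,
    TemperedDistribution.smulLeftCLM_smulLeftCLM_apply hasTemperateGrowth_besselSymbol (by fun_prop)]
  convert! (TemperedDistribution.smulLeftCLM_const 1 (fourierL2 h : 𝓢'(ℝ, ℂ))) using 2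
  · congr 1
    ext x
    simpa [mul_comm] using bessel_rpow_mul x
  · simp

theorem exists_multiplier_besselSymbol_eq {f : L2} (hf : f ∈ sobolevH2) :
    ∃ h, multiplier besselSymbol h = f := by
  obtain ⟨f', hf'⟩ := TemperedDistribution.memSobolev_iff_exists_smulLeftCLM_fourier.1 hf
  refine ⟨fourierL2.symm f', ?_⟩
  rw [multiplier_apply, fourierL2.apply_symm_apply, LinearIsometryEquiv.symm_apply_eq]
  apply toTemperedDistribution_injective
  rw [toTemperedDistribution_mulCLM hasTemperateGrowth_besselSymbol, ← hf',
    TemperedDistribution.smulLeftCLM_smulLeftCLM_apply (by fun_prop) hasTemperateGrowth_besselSymbol,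
    Lp.fourier_toTemperedDistribution_eq]
  convert! (TemperedDistribution.smulLeftCLM_const 1 (fourierL2 f : 𝓢'(ℝ, ℂ))) using 2
  · congr 1
    ext x
    simpa [mul_comm] using bessel_rpow_mul x
  · simp

theorem multiplier_besselSymbol_injective : Function.Injective (multiplier besselSymbol) :=
  multiplier_injective (Eventually.of_forall fun x =>
    right_ne_zero_of_mul_eq_one (bessel_rpow_mul x))

/-- With the Fourier kernel `exp(-2πixξ)` each derivative becomes multiplication by `2πiξ`, so
`-∂ₓₓ` has symbol `4π²ξ²`. -/
theorem secondDeriv_multiplier_besselSymbol (h : L2) :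
    secondDeriv ⟨multiplier besselSymbol h, multiplier_besselSymbol_mem h⟩ =
      -multiplier laplaceSymbol h := by
  rw [← neg_eq_iff_eq_neg]
  apply toTemperedDistribution_injective
  rw [← Lp.toTemperedDistributionCLM_apply, map_neg, Lp.toTemperedDistributionCLM_apply,
    secondDeriv_spec]
  refine Function.LeftInverse.injective (g := fun f : 𝓢'(ℝ, ℂ) => 𝓕⁻ f) (f := fun f => 𝓕 f)
    FourierTransform.fourierInv_fourier_eq ?_
  change 𝓕 _ = 𝓕 _
  have hi : (fun x : ℝ => Complex.ofReal (inner ℝ x (1 : ℝ))).HasTemperateGrowth := by fun_prop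
  have hfun : (laplaceSymbol : ℝ → ℂ) = (-(2 * Real.pi * Complex.I) ^ 2) •
      (((besselSymbol : ℝ → ℂ) * fun x : ℝ => Complex.ofReal (inner ℝ x (1 : ℝ))) *
        fun x : ℝ => Complex.ofReal (inner ℝ x (1 : ℝ))) := by
    ext x
    simp only [laplaceSymbol_apply, besselSymbol_apply, Pi.smul_apply, Pi.mul_apply, smul_eq_mul,
      RCLike.inner_apply, conj_trivial, one_mul, mul_pow, Complex.I_sq]
    push_cast
    ring
  rw [fourier_toTemperedDistribution_multiplier hasTemperateGrowth_laplaceSymbol,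
    FourierTransform.fourier_neg, TemperedDistribution.fourier_lineDerivOp_eq,
    TemperedDistribution.fourier_lineDerivOp_eq,
    fourier_toTemperedDistribution_multiplier hasTemperateGrowth_besselSymbol,
    map_smul, TemperedDistribution.smulLeftCLM_smulLeftCLM_apply hasTemperateGrowth_besselSymbol hi,
    TemperedDistribution.smulLeftCLM_smulLeftCLM_apply
      (hasTemperateGrowth_besselSymbol.mul hi) hi, hfun, TemperedDistribution.smulLeftCLM_smul
      ((hasTemperateGrowth_besselSymbol.mul hi).mul hi), smul_smul, ← sq, smul_apply, neg_smul]

end LugiatoLefever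
end

/-! ### Integral operators with square integrable kernel -/

noncomputable section

namespace LugiatoLefever

open UnboundedOperator
open scoped BoundedContinuousFunction FourierTransform

/-- The operator `g ↦ (x ↦ k x g)` with values in `L²(ℝ)`, for a square integrable family `k` of
functionals. -/
def kernelCLM (E : Type*) [NormedAddCommGroup E] [NormedSpace ℂ E] :
    Lp (E →L[ℂ] ℂ) 2 (volume : Measure ℝ) →L[ℂ] E →L[ℂ] L2 :=
  LinearMap.mkContinuous₂
    (LinearMap.mk₂ ℂ (fun k g => (ContinuousLinearMap.apply ℂ ℂ g).compLp k)
      (fun k k' g => map_add ((ContinuousLinearMap.apply ℂ ℂ g).compLpL 2 volume) k k')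
      (fun c k g => map_smul ((ContinuousLinearMap.apply ℂ ℂ g).compLpL 2 volume) c k)
      (fun k g g' => by rw [map_add, ContinuousLinearMap.add_compLp])
      (fun c k g => by rw [map_smul, ContinuousLinearMap.smul_compLp])) 1 fun k g => by
    refine (ContinuousLinearMap.norm_compLp_le _ _).trans ?_
    rw [one_mul, mul_comm]
    refine mul_le_mul_of_nonneg_left ?_ (norm_nonneg _)
    refine ContinuousLinearMap.opNorm_le_bound _ (norm_nonneg _) fun f => ?_
    rw [mul_comm]
    exact f.le_opNorm g

theorem coeFn_kernelCLM {E : Type*} [NormedAddCommGroup E] [NormedSpace ℂ E]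
    (k : Lp (E →L[ℂ] ℂ) 2 (volume : Measure ℝ)) (g : E) :
    kernelCLM E k g =ᵐ[volume] fun x => k x g :=
  ContinuousLinearMap.coeFn_compLp (ContinuousLinearMap.apply ℂ ℂ g) k

/-- A kernel `c` times an indicator gives an operator of rank at most one, sums of such kernels are
dense in `L²`, and the operator depends continuously on its kernel. -/
theorem kernelCLM_mem_approxFiniteRank {E : Type*} [NormedAddCommGroup E] [NormedSpace ℂ E]
    (k : Lp (E →L[ℂ] ℂ) 2 (volume : Measure ℝ)) : kernelCLM E k ∈ approxFiniteRank E L2 := by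
  refine Lp.induction (by norm_num) (fun k => kernelCLM E k ∈ approxFiniteRank E L2) ?_ ?_ ?_ k
  · intro c s hs hμ
    refine subset_closure ?_
    refine Submodule.finiteDimensional_of_le
      (S₂ := Submodule.span ℂ {indicatorConstLp 2 hs hμ.ne (1 : ℂ)}) ?_
    rintro _ ⟨g, rfl⟩
    refine Submodule.mem_span_singleton.2 ⟨c g, ?_⟩
    refine Lp.ext ?_
    have h1 := coeFn_kernelCLM
      ((Lp.simpleFunc.indicatorConst 2 hs hμ.ne c : Lp.simpleFunc _ 2 volume) : Lp _ 2 volume) g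
    rw [Lp.simpleFunc.coe_indicatorConst] at h1 ⊢
    filter_upwards [h1, indicatorConstLp_coeFn (p := 2) (hs := hs) (hμs := hμ.ne) (c := c),
      indicatorConstLp_coeFn (p := 2) (hs := hs) (hμs := hμ.ne) (c := (1 : ℂ)),
      Lp.coeFn_smul (c g) (indicatorConstLp 2 hs hμ.ne (1 : ℂ))] with x h1 h2 h3 h4
    refine h4.trans (Eq.trans ?_ h1.symm)
    rw [Pi.smul_apply, h2, h3]
    by_cases hx : x ∈ s <;> simp [hx]
  · intro f g hf hg _ h1 h2
    rw [map_add]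
    exact add_mem h1 h2
  · exact (Submodule.isClosed_topologicalClosure _).preimage (kernelCLM E).continuous

/-! ### The square integrable kernel of a multiplication operator composed with a Bessel potential
-/

theorem memLp_abs_mul_inv : MemLp (fun ξ : ℝ => |ξ| * (1 + ξ ^ 2)⁻¹) 2 := by
  refine (memLp_two_iff_integrable_sq (by fun_prop)).2 ?_
  refine integrable_inv_one_add_sq.mono' (by fun_prop) (Eventually.of_forall fun ξ => ?_)
  rw [Real.norm_of_nonneg (by positivity), mul_pow, sq_abs, inv_pow, ← div_eq_mul_inv,
    div_le_iff₀ (by positivity), sq (1 + ξ ^ 2), ← mul_assoc, inv_mul_cancel₀ (by positivity)]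
  linarith

/-- The symbol `(1 + ξ²)⁻¹` is square integrable. -/
theorem memLp_besselSymbol : MemLp besselSymbol 2 (volume : Measure ℝ) := by
  have h1 : MemLp (fun ξ : ℝ => (1 + ξ ^ 2)⁻¹) 2 := by
    refine (memLp_two_iff_integrable_sq (by fun_prop)).2 ?_
    refine integrable_inv_one_add_sq.mono' (by fun_prop) (Eventually.of_forall fun ξ => ?_)
    rw [Real.norm_of_nonneg (by positivity), sq]
    exact mul_le_of_le_one_left (by positivity) (inv_le_one_of_one_le₀ (by nlinarith [sq_nonneg ξ]))
  exact h1.ofReal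

theorem memLp_expBessel (x : ℝ) :
    MemLp (fun ξ : ℝ => (𝐞 (-(ξ * x)) : ℂ) * besselSymbol ξ) 2 (volume : Measure ℝ) := by
  refine memLp_besselSymbol.of_le (by fun_prop) (Eventually.of_forall fun ξ => ?_)
  rw [norm_mul, Circle.norm_coe, one_mul]

/-- The function `ξ ↦ exp (-2 π i x ξ) (1 + ξ²)⁻¹` in `L²(ℝ)`. -/
def expBessel (x : ℝ) : L2 := (memLp_expBessel x).toLp _

theorem norm_fourierChar_sub_le (s t : ℝ) :
    ‖(𝐞 s : ℂ) - 𝐞 t‖ ≤ 2 * Real.pi * |s - t| := by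
  rw [Real.fourierChar_apply, Real.fourierChar_apply]
  have h := Real.norm_exp_I_mul_ofReal_sub_one_le (x := 2 * Real.pi * (s - t))
  have h1 : Complex.exp (↑(2 * Real.pi * s) * Complex.I) - Complex.exp (↑(2 * Real.pi * t) * Complex.I)
      = Complex.exp (↑(2 * Real.pi * t) * Complex.I) *
        (Complex.exp (Complex.I * ↑(2 * Real.pi * (s - t))) - 1) := by
    rw [mul_sub, ← Complex.exp_add, mul_one]
    congr 2
    push_cast
    ring
  rw [h1, norm_mul, Complex.norm_exp_ofReal_mul_I, one_mul]
  refine h.trans_eq ?_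
  rw [Real.norm_eq_abs, abs_mul, abs_of_pos Real.two_pi_pos]

/-- Differences of phases are at most `2π|x - y||ξ|`, and `|ξ|(1 + ξ²)⁻¹` is square integrable, so
the map is Lipschitz. Continuity serves to make the kernel measurable. -/
theorem continuous_expBessel : Continuous expBessel := by
  let γ : Lp ℝ 2 (volume : Measure ℝ) := memLp_abs_mul_inv.toLp _
  have hL : ∀ x y, ‖expBessel x - expBessel y‖ ≤ 2 * Real.pi * |x - y| * ‖γ‖ := by
    intro x y
    refine Lp.norm_le_mul_norm_of_ae_le_mul ?_
    filter_upwards [Lp.coeFn_sub (expBessel x) (expBessel y), (memLp_expBessel x).coeFn_toLp,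
      (memLp_expBessel y).coeFn_toLp, memLp_abs_mul_inv.coeFn_toLp] with ξ h1 h2 h3 h4
    rw [h1, Pi.sub_apply, expBessel, expBessel, h2, h3, h4, ← sub_mul, norm_mul,
      Real.norm_of_nonneg (by positivity), besselSymbol_apply, Complex.norm_real,
      Real.norm_of_nonneg (by positivity), ← mul_assoc]
    refine mul_le_mul_of_nonneg_right ?_ (by positivity)
    refine (norm_fourierChar_sub_le _ _).trans_eq ?_
    have h5 : -(ξ * x) - -(ξ * y) = -((x - y) * ξ) := by ring
    rw [h5, abs_neg, abs_mul, mul_assoc (2 * Real.pi)]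
  have h2 : LipschitzWith (Real.toNNReal (2 * Real.pi * ‖γ‖)) expBessel := by
    refine LipschitzWith.of_dist_le' fun x y => ?_
    rw [dist_eq_norm, Real.dist_eq]
    exact (hL x y).trans_eq (by ring)
  exact h2.continuous

/-- The norm of `expBessel x` does not depend on `x`, so the kernel is square integrable as soon as
`v` is. -/
theorem memLp_kernel {v : ℝ →ᵇ ℂ} (hv : MemLp v 2 (volume : Measure ℝ)) :
    MemLp (fun x => v x • innerSL ℂ (expBessel x)) 2 (volume : Measure ℝ) := by
  have hc : Continuous fun x => v x • innerSL ℂ (expBessel x) :=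
    v.continuous.smul ((innerSL ℂ).continuous.comp continuous_expBessel)
  refine MemLp.of_le_mul (c := ‖expBessel 0‖) hv hc.aestronglyMeasurable
    (Eventually.of_forall fun x => ?_)
  have h : ‖expBessel x‖ ≤ ‖expBessel 0‖ := by
    refine Lp.norm_le_norm_of_ae_le ?_
    filter_upwards [(memLp_expBessel x).coeFn_toLp, (memLp_expBessel 0).coeFn_toLp] with ξ h1 h2
    rw [expBessel, expBessel, h1, h2, norm_mul, norm_mul, Circle.norm_coe, Circle.norm_coe]
  rw [norm_smul, innerSL_apply_norm, mul_comm]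
  exact mul_le_mul_of_nonneg_right h (norm_nonneg _)

/-- On Schwartz functions the inverse Fourier transform is an honest integral, namely the inner
product with `expBessel x`; the inner product conjugates its first argument, whence the minus sign
in the phase there. -/
theorem mulCLM_fourierInv_toLp_eq_kernelCLM {v : ℝ →ᵇ ℂ} (hv : MemLp v 2 (volume : Measure ℝ))
    (f : 𝓢(ℝ, ℂ)) : mulCLM v (fourierL2.symm (mulCLM besselSymbol (f.toLp 2))) =
      kernelCLM L2 ((memLp_kernel hv).toLp _) (f.toLp 2) := by
  have h1 : mulCLM besselSymbol (f.toLp 2) = (SchwartzMap.smulLeftCLM ℂ besselSymbol f).toLp 2 := by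
    refine Lp.ext ?_
    filter_upwards [coeFn_mulCLM besselSymbol (f.toLp 2), f.coeFn_toLp 2 volume,
      (SchwartzMap.smulLeftCLM ℂ besselSymbol f).coeFn_toLp 2 volume] with x h1 h2 h3
    rw [h1, h2, h3, SchwartzMap.smulLeftCLM_apply_apply hasTemperateGrowth_besselSymbol, smul_eq_mul]
  rw [h1]
  have h2 : fourierL2.symm ((SchwartzMap.smulLeftCLM ℂ besselSymbol f).toLp 2) =
      (𝓕⁻ (SchwartzMap.smulLeftCLM ℂ besselSymbol f)).toLp 2 :=
    SchwartzMap.toLp_fourierInv_eq _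
  rw [h2]
  refine Lp.ext ?_
  filter_upwards [coeFn_mulCLM v ((𝓕⁻ (SchwartzMap.smulLeftCLM ℂ besselSymbol f)).toLp 2),
    (𝓕⁻ (SchwartzMap.smulLeftCLM ℂ besselSymbol f)).coeFn_toLp 2 volume,
    coeFn_kernelCLM ((memLp_kernel hv).toLp _) (f.toLp 2), (memLp_kernel hv).coeFn_toLp]
    with x h3 h4 h5 h6
  rw [h3, h4, h5, h6, smul_apply, innerSL_apply_apply, smul_eq_mul, L2.inner_def]
  congr 1
  rw [SchwartzMap.fourierInv_coe, Real.fourierInv_eq]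
  refine integral_congr_ae ?_
  filter_upwards [(memLp_expBessel x).coeFn_toLp, f.coeFn_toLp 2 volume] with ξ h7 h8
  have hin : inner ℝ ξ x = ξ * x := by simp [mul_comm]
  have hconj : (starRingEnd ℂ) (𝐞 (-(ξ * x)) : ℂ) = 𝐞 (ξ * x) := by
    rw [← Circle.coe_inv_eq_conj, AddChar.map_neg_eq_inv, inv_inv]
  have hinner : ∀ a b : ℂ, inner ℂ a b = b * (starRingEnd ℂ) a := fun a b => rfl
  rw [expBessel, h7, h8, SchwartzMap.smulLeftCLM_apply_apply hasTemperateGrowth_besselSymbol,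
    hinner, map_mul, hconj, besselSymbol_apply, Complex.conj_ofReal, Circle.smul_def, hin,
    smul_eq_mul, smul_eq_mul]
  ring

theorem mulCLM_fourierInv_eq_kernelCLM {v : ℝ →ᵇ ℂ} (hv : MemLp v 2 (volume : Measure ℝ))
    (h : L2) : mulCLM v (fourierL2.symm (mulCLM besselSymbol h)) =
      kernelCLM L2 ((memLp_kernel hv).toLp _) h := by
  have hd := SchwartzMap.denseRange_toLpCLM (F := ℂ) (E := ℝ) (p := 2) (μ := volume)
    ENNReal.ofNat_ne_top
  let S : L2 →L[ℂ] L2 := mulCLM v ∘L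
    fourierL2.symm.toContinuousLinearEquiv.toContinuousLinearMap ∘L mulCLM besselSymbol
  let T : L2 →L[ℂ] L2 := kernelCLM L2 ((memLp_kernel hv).toLp _)
  have h1 : (S : L2 → L2) = T := by
    refine hd.equalizer S.continuous T.continuous ?_
    ext1 f
    exact mulCLM_fourierInv_toLp_eq_kernelCLM hv f
  exact congrFun h1 h

/-- Multiplication by a bounded square integrable function is relatively compact with respect to
the second derivative. -/
theorem mulCLM_comp_multiplier_mem {v : ℝ →ᵇ ℂ} (hv : MemLp v 2 (volume : Measure ℝ)) :
    mulCLM v ∘L multiplier besselSymbol ∈ approxFiniteRank L2 L2 := by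
  have h : mulCLM v ∘L multiplier besselSymbol = kernelCLM L2 ((memLp_kernel hv).toLp _) ∘L
      fourierL2.toContinuousLinearEquiv.toContinuousLinearMap := by
    ext1 f
    exact mulCLM_fourierInv_eq_kernelCLM hv (fourierL2 f)
  rw [h]
  exact mem_approxFiniteRank_comp (kernelCLM_mem_approxFiniteRank _) _

end LugiatoLefever
end

/-! ### Block operators on `L²(ℝ) × L²(ℝ)` -/

noncomputable section

namespace LugiatoLefever

open UnboundedOperator
open scoped BoundedContinuousFunction FourierTransform

/-- The block operator with the given entries. -/
def block (a b c d : L2 →L[ℂ] L2) : L2Pair →L[ℂ] L2Pair :=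
  let e := WithLp.prodContinuousLinearEquiv 2 ℂ L2 L2
  let i₁ : L2 →L[ℂ] L2Pair := e.symm.toContinuousLinearMap ∘L ContinuousLinearMap.inl ℂ L2 L2
  let i₂ : L2 →L[ℂ] L2Pair := e.symm.toContinuousLinearMap ∘L ContinuousLinearMap.inr ℂ L2 L2
  let p₁ : L2Pair →L[ℂ] L2 := ContinuousLinearMap.fst ℂ L2 L2 ∘L e.toContinuousLinearMap
  let p₂ : L2Pair →L[ℂ] L2 := ContinuousLinearMap.snd ℂ L2 L2 ∘L e.toContinuousLinearMap
  i₁ ∘L a ∘L p₁ + i₁ ∘L b ∘L p₂ + i₂ ∘L c ∘L p₁ + i₂ ∘L d ∘L p₂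

theorem block_apply (a b c d : L2 →L[ℂ] L2) (y : L2Pair) :
    block a b c d y = WithLp.toLp 2 (a y.fst + b y.snd, c y.fst + d y.snd) := by
  apply WithLp.ofLp_injective 2
  refine Prod.ext ?_ ?_
  · change a y.fst + b y.snd + 0 + 0 = a y.fst + b y.snd
    rw [add_zero, add_zero]
  · change 0 + 0 + c y.fst + d y.snd = c y.fst + d y.snd
    rw [add_zero, zero_add]

theorem block_mem_approxFiniteRank {a b c d : L2 →L[ℂ] L2} (ha : a ∈ approxFiniteRank L2 L2)
    (hb : b ∈ approxFiniteRank L2 L2) (hc : c ∈ approxFiniteRank L2 L2)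
    (hd : d ∈ approxFiniteRank L2 L2) : block a b c d ∈ approxFiniteRank L2Pair L2Pair :=
  add_mem (add_mem (add_mem
    (comp_mem_approxFiniteRank _ (mem_approxFiniteRank_comp ha _))
    (comp_mem_approxFiniteRank _ (mem_approxFiniteRank_comp hb _)))
    (comp_mem_approxFiniteRank _ (mem_approxFiniteRank_comp hc _)))
    (comp_mem_approxFiniteRank _ (mem_approxFiniteRank_comp hd _))

theorem block_mul (a b c d a' b' c' d' : L2 →L[ℂ] L2) :
    block a b c d * block a' b' c' d' =
      block (a * a' + b * c') (a * b' + b * d') (c * a' + d * c') (c * b' + d * d') := by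
  ext1 y
  rw [mul_apply_eq_comp, block_apply, block_apply, block_apply]
  apply WithLp.ofLp_injective 2
  refine Prod.ext ?_ ?_
  · change a (a' y.fst + b' y.snd) + b (c' y.fst + d' y.snd) =
      (a (a' y.fst) + b (c' y.fst)) + (a (b' y.snd) + b (d' y.snd))
    rw [map_add, map_add]
    abel
  · change c (a' y.fst + b' y.snd) + d (c' y.fst + d' y.snd) =
      (c (a' y.fst) + d (c' y.fst)) + (c (b' y.snd) + d (d' y.snd))
    rw [map_add, map_add]
    abel

theorem block_one : block 1 0 0 1 = 1 := by
  ext1 y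
  rw [block_apply]
  apply WithLp.ofLp_injective 2
  refine Prod.ext ?_ ?_ <;> simp

theorem block_add (a b c d a' b' c' d' : L2 →L[ℂ] L2) :
    block a b c d + block a' b' c' d' = block (a + a') (b + b') (c + c') (d + d') := by
  ext1 y
  rw [add_apply, block_apply, block_apply, block_apply]
  apply WithLp.ofLp_injective 2
  refine Prod.ext ?_ ?_ <;>
  · simp only [WithLp.ofLp_add, Prod.fst_add, Prod.snd_add, add_apply]
    abel

theorem block_smul (z : ℂ) (a b c d : L2 →L[ℂ] L2) :
    z • block a b c d = block (z • a) (z • b) (z • c) (z • d) := by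
  ext1 y
  rw [smul_apply, block_apply, block_apply]
  apply WithLp.ofLp_injective 2
  refine Prod.ext ?_ ?_ <;> simp

theorem norm_toLp_le (f g : L2) : ‖(WithLp.toLp 2 (f, g) : L2Pair)‖ ≤ ‖f‖ + ‖g‖ := by
  rw [WithLp.prod_norm_eq_of_L2]
  refine Real.sqrt_le_iff.2 ⟨by positivity, ?_⟩
  change ‖f‖ ^ 2 + ‖g‖ ^ 2 ≤ _
  nlinarith [norm_nonneg f, norm_nonneg g]

theorem norm_block_le (a b c d : L2 →L[ℂ] L2) :
    ‖block a b c d‖ ≤ ‖a‖ + ‖b‖ + ‖c‖ + ‖d‖ := by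
  refine ContinuousLinearMap.opNorm_le_bound _ (by positivity) fun y => ?_
  rw [block_apply]
  refine (norm_toLp_le _ _).trans ?_
  have ha := a.le_opNorm_of_le (WithLp.norm_fst_le L2 y)
  have hb := b.le_opNorm_of_le (WithLp.norm_snd_le L2 y)
  have hc := c.le_opNorm_of_le (WithLp.norm_fst_le L2 y)
  have hd := d.le_opNorm_of_le (WithLp.norm_snd_le L2 y)
  linarith [norm_add_le (a y.fst) (b y.snd), norm_add_le (c y.fst) (d y.snd)]

/-- The Fourier multiplier with a matrix-valued symbol. -/
def matMultiplier (p q r s : ℝ →ᵇ ℂ) : L2Pair →L[ℂ] L2Pair :=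
  block (multiplier p) (multiplier q) (multiplier r) (multiplier s)

theorem matMultiplier_mul (p q r s p' q' r' s' : ℝ →ᵇ ℂ) :
    matMultiplier p q r s * matMultiplier p' q' r' s' =
      matMultiplier (p * p' + q * r') (p * q' + q * s') (r * p' + s * r') (r * q' + s * s') := by
  simp only [matMultiplier, block_mul, map_add, map_mul]

theorem matMultiplier_one : matMultiplier 1 0 0 1 = 1 := by
  simp only [matMultiplier, map_one, map_zero, block_one]

theorem norm_matMultiplier_le {C : ℝ} {p q r s : ℝ →ᵇ ℂ} (hC : 0 ≤ C) (hp : ∀ x, ‖p x‖ ≤ C)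
    (hq : ∀ x, ‖q x‖ ≤ C) (hr : ∀ x, ‖r x‖ ≤ C) (hs : ∀ x, ‖s x‖ ≤ C) :
    ‖matMultiplier p q r s‖ ≤ 4 * C := by
  refine (norm_block_le _ _ _ _).trans ?_
  have h : ∀ φ : ℝ →ᵇ ℂ, (∀ x, ‖φ x‖ ≤ C) → ‖multiplier φ‖ ≤ C := fun φ hφ =>
    (norm_multiplier_le φ).trans ((BoundedContinuousFunction.norm_le hC).2 hφ)
  linarith [h p hp, h q hq, h r hr, h s hs]

/-- A Fourier multiplier whose symbol has a zero is not bounded below. -/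
theorem exists_norm_multiplier_le {μ : ℝ →ᵇ ℂ} {ξ : ℝ} (hμ : μ ξ = 0) {δ : ℝ} (hδ : 0 < δ) :
    ∃ h : L2, h ≠ 0 ∧ ‖multiplier μ h‖ ≤ δ * ‖h‖ := by
  obtain ⟨r, hr, hball⟩ := Metric.continuousAt_iff.1 (μ.continuous.continuousAt (x := ξ)) δ hδ
  have hm : MeasurableSet (Metric.ball ξ r) := Metric.isOpen_ball.measurableSet
  have hv : volume (Metric.ball ξ r) ≠ ∞ := measure_ball_lt_top.ne
  set f : L2 := indicatorConstLp 2 hm hv (1 : ℂ) with hf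
  have hf0 : f ≠ 0 := by
    intro h0
    have h1 := norm_indicatorConstLp (p := 2) (hs := hm) (hμs := hv) (c := (1 : ℂ))
      (by norm_num) (by norm_num)
    rw [← hf, h0, norm_zero, norm_one, one_mul] at h1
    have h2 : 0 < volume.real (Metric.ball ξ r) :=
      ENNReal.toReal_pos (Metric.measure_ball_pos _ _ hr).ne' hv
    exact (Real.rpow_pos_of_pos h2 _).ne h1
  refine ⟨fourierL2.symm f, by simpa using hf0, ?_⟩
  rw [multiplier_apply, fourierL2.apply_symm_apply, LinearIsometryEquiv.norm_map,
    LinearIsometryEquiv.norm_map]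
  refine Lp.norm_le_mul_norm_of_ae_le_mul ?_
  filter_upwards [coeFn_mulCLM μ f,
    indicatorConstLp_coeFn (p := 2) (hs := hm) (hμs := hv) (c := (1 : ℂ))] with x h1 h2
  rw [h1, norm_mul, hf, h2]
  by_cases hx : x ∈ Metric.ball ξ r
  · have h3 := hball hx
    rw [hμ, dist_zero_right] at h3
    exact mul_le_mul_of_nonneg_right h3.le (norm_nonneg _)
  · simp [hx]

end LugiatoLefever
end

/-! ### The constant coefficient operator -/

noncomputable section

namespace LugiatoLefever

open UnboundedOperator
open scoped BoundedContinuousFunction FourierTransform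

/-- The symbol `(4 π² ξ² + a) (1 + ξ²)⁻¹`. -/
def shiftedSymbol (a : ℝ) : ℝ →ᵇ ℂ := laplaceSymbol + algebraMap ℂ (ℝ →ᵇ ℂ) a * besselSymbol

theorem shiftedSymbol_apply (a ξ : ℝ) :
    shiftedSymbol a ξ = ((((2 * Real.pi * ξ) ^ 2 + a) * (1 + ξ ^ 2)⁻¹ : ℝ) : ℂ) := by
  rw [shiftedSymbol, BoundedContinuousFunction.add_apply, BoundedContinuousFunction.mul_apply,
    laplaceSymbol_apply, besselSymbol_apply, BoundedContinuousFunction.algebraMap_apply]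
  push_cast
  simp only [smul_eq_mul]
  ring

/-- The bounded operator `(J L_∞ - z) (1 - (2π)⁻² ∂ₓₓ)⁻¹`, where `L_∞` is the diagonal operator with
entries `-∂ₓₓ + a` and `-∂ₓₓ + b`. -/
def freePencil (a b : ℝ) (z : ℂ) : L2Pair →L[ℂ] L2Pair :=
  matMultiplier (-(algebraMap ℂ (ℝ →ᵇ ℂ) z * besselSymbol)) (shiftedSymbol b) (-shiftedSymbol a)
    (-(algebraMap ℂ (ℝ →ᵇ ℂ) z * besselSymbol))

/-- The determinant of the symbol of `freePencil`. -/
def detSymbol (a b : ℝ) (z : ℂ) : ℝ →ᵇ ℂ :=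
  (algebraMap ℂ (ℝ →ᵇ ℂ) z * besselSymbol) ^ 2 + shiftedSymbol a * shiftedSymbol b

/-- The adjugate of `freePencil`. -/
def freeAdjugate (a b : ℝ) (z : ℂ) : L2Pair →L[ℂ] L2Pair :=
  matMultiplier (-(algebraMap ℂ (ℝ →ᵇ ℂ) z * besselSymbol)) (-shiftedSymbol b) (shiftedSymbol a)
    (-(algebraMap ℂ (ℝ →ᵇ ℂ) z * besselSymbol))

theorem freeAdjugate_mul_freePencil (a b : ℝ) (z : ℂ) :
    freeAdjugate a b z * freePencil a b z = matMultiplier (detSymbol a b z) 0 0 (detSymbol a b z) := by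
  rw [freeAdjugate, freePencil, matMultiplier_mul, detSymbol]
  congr 1 <;> ring

theorem freePencil_mul_freeAdjugate (a b : ℝ) (z : ℂ) :
    freePencil a b z * freeAdjugate a b z = matMultiplier (detSymbol a b z) 0 0 (detSymbol a b z) := by
  rw [freeAdjugate, freePencil, matMultiplier_mul, detSymbol]
  congr 1 <;> ring

theorem detSymbol_apply (a b : ℝ) (z : ℂ) (ξ : ℝ) :
    detSymbol a b z ξ = (((1 + ξ ^ 2)⁻¹ ^ 2 : ℝ) : ℂ) *
      (z ^ 2 + ((((2 * Real.pi * ξ) ^ 2 + a) * ((2 * Real.pi * ξ) ^ 2 + b) : ℝ) : ℂ)) := by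
  simp only [detSymbol, BoundedContinuousFunction.add_apply, BoundedContinuousFunction.mul_apply,
    sq (algebraMap ℂ (ℝ →ᵇ ℂ) z * besselSymbol), shiftedSymbol_apply, besselSymbol_apply,
    BoundedContinuousFunction.algebraMap_apply, smul_eq_mul]
  push_cast
  ring

/-- In the variable `τ = (1 + ξ²)⁻¹` the symbol is a polynomial on the compact interval `[0, 1]`. At
`τ = 0`, which is `ξ = ∞`, its value is `(2π)⁴`, so it is bounded away from zero. -/
theorem exists_inverse_detSymbol {a b : ℝ} {z : ℂ}
    (h : ∀ ξ : ℝ, z ^ 2 + ((((2 * Real.pi * ξ) ^ 2 + a) * ((2 * Real.pi * ξ) ^ 2 + b) : ℝ) : ℂ) ≠ 0) :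
    ∃ e : ℝ →ᵇ ℂ, e * detSymbol a b z = 1 := by
  let P : ℝ → ℂ := fun τ => z ^ 2 * (τ : ℂ) ^ 2 + ((((2 * Real.pi) ^ 2 * (1 - τ) + a * τ) *
    ((2 * Real.pi) ^ 2 * (1 - τ) + b * τ) : ℝ) : ℂ)
  have hP : ∀ ξ, detSymbol a b z ξ = P ((1 + ξ ^ 2)⁻¹) := by
    intro ξ
    have h1 : (1 : ℝ) + ξ ^ 2 ≠ 0 := by positivity
    have h2 : ((2 * Real.pi) ^ 2 * (1 - (1 + ξ ^ 2)⁻¹) : ℝ) =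
      (2 * Real.pi * ξ) ^ 2 * (1 + ξ ^ 2)⁻¹ := by field_simp; ring
    simp only [P, h2, detSymbol_apply]
    push_cast
    ring
  have hne : ∀ τ ∈ Set.Icc (0 : ℝ) 1, P τ ≠ 0 := by
    rintro τ ⟨h0, h1⟩
    rcases h0.eq_or_lt with rfl | h0
    · simp [P, Real.pi_ne_zero]
    · have hτ : τ = (1 + √(τ⁻¹ - 1) ^ 2)⁻¹ := by
        rw [Real.sq_sqrt (by linarith [(one_le_inv₀ h0).2 h1])]
        simp
      rw [hτ, ← hP, detSymbol_apply]
      refine mul_ne_zero ?_ (h _)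
      exact_mod_cast (by positivity : (1 + √(τ⁻¹ - 1) ^ 2)⁻¹ ^ 2 ≠ 0)
  have hPc : Continuous P := by fun_prop
  obtain ⟨τ₀, hτ₀, hmin⟩ := isCompact_Icc.exists_isMinOn (Set.nonempty_Icc.2 zero_le_one)
    (hPc.norm.continuousOn (s := Set.Icc (0 : ℝ) 1))
  have hmem : ∀ ξ : ℝ, (1 + ξ ^ 2)⁻¹ ∈ Set.Icc (0 : ℝ) 1 := fun ξ =>
    ⟨by positivity, inv_le_one_of_one_le₀ (by nlinarith [sq_nonneg ξ])⟩
  have hD : ∀ ξ, detSymbol a b z ξ ≠ 0 := fun ξ => by rw [hP]; exact hne _ (hmem ξ)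
  refine ⟨BoundedContinuousFunction.ofNormedAddCommGroup (fun ξ => (detSymbol a b z ξ)⁻¹)
    ((detSymbol a b z).continuous.inv₀ hD) ‖P τ₀‖⁻¹ fun ξ => ?_, ?_⟩
  · rw [norm_inv, hP]
    exact inv_anti₀ (norm_pos_iff.2 (hne _ hτ₀)) (hmin (hmem ξ))
  · ext ξ
    exact inv_mul_cancel₀ (hD ξ)

theorem freePencil_inverse {a b : ℝ} {z : ℂ} {e : ℝ →ᵇ ℂ} (he : e * detSymbol a b z = 1) :
    freePencil a b z * (freeAdjugate a b z * matMultiplier e 0 0 e) = 1 ∧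
      (matMultiplier e 0 0 e * freeAdjugate a b z) * freePencil a b z = 1 := by
  constructor
  · rw [← mul_assoc, freePencil_mul_freeAdjugate, matMultiplier_mul]
    simp only [mul_zero, add_zero, zero_add, mul_comm _ e, he, matMultiplier_one]
  · rw [mul_assoc, freeAdjugate_mul_freePencil, matMultiplier_mul]
    simp only [mul_zero, zero_mul, add_zero, zero_add, he, matMultiplier_one]

theorem isUnit_freePencil {a b : ℝ} {z : ℂ}
    (h : ∀ ξ : ℝ, z ^ 2 + ((((2 * Real.pi * ξ) ^ 2 + a) * ((2 * Real.pi * ξ) ^ 2 + b) : ℝ) : ℂ) ≠ 0) :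
    IsUnit (freePencil a b z) := by
  obtain ⟨e, he⟩ := exists_inverse_detSymbol h
  obtain ⟨h1, h2⟩ := freePencil_inverse he
  have h3 := left_inv_eq_right_inv h2 h1
  exact ⟨⟨_, _, h1, h3 ▸ h2⟩, rfl⟩

/-- The bounded operator `(1 - (2π)⁻² ∂ₓₓ)⁻¹`, acting diagonally. -/
def besselPair : L2Pair →L[ℂ] L2Pair := matMultiplier besselSymbol 0 0 besselSymbol

/-- `b(w² + pq) ≥ a(w² + q²) ≥ 2aqw`, which is more than needed. -/
theorem symbol_ratio_bound {a b p q w : ℝ} (ha : 0 < a) (hab : a ≤ b) (hp : 0 < p)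
    (hq : 0 < q) (hpq : a * q ≤ b * p) (hw : 0 < w) : q / (w ^ 2 + p * q) ≤ b / a / w := by
  rw [div_div, div_le_div_iff₀ (by positivity) (by positivity)]
  have h1 : a * q * q ≤ b * p * q := by nlinarith
  have h2 : w ^ 2 * a ≤ w ^ 2 * b := by nlinarith [sq_nonneg w]
  nlinarith [mul_nonneg ha.le (sq_nonneg (q - w)), mul_pos hq hw, mul_pos (mul_pos ha hq) hw]

/-- The resolvent of the constant coefficient operator decays along the positive real axis. -/
theorem exists_besselPair_eq_mul_freePencil {a b w : ℝ} (ha : 0 < a) (hab : a ≤ b) (hw : 0 < w) :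
    ∃ R : L2Pair →L[ℂ] L2Pair, besselPair = R * freePencil a b w ∧ ‖R‖ ≤ 4 * (b / a / w) := by
  have hb : 0 < b := ha.trans_le hab
  have hne : ∀ ξ : ℝ, ((w : ℂ)) ^ 2 +
      ((((2 * Real.pi * ξ) ^ 2 + a) * ((2 * Real.pi * ξ) ^ 2 + b) : ℝ) : ℂ) ≠ 0 := fun ξ => by
    have : 0 < w ^ 2 + ((2 * Real.pi * ξ) ^ 2 + a) * ((2 * Real.pi * ξ) ^ 2 + b) := by positivity
    exact_mod_cast this.ne'
  obtain ⟨e, he⟩ := exists_inverse_detSymbol hne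
  refine ⟨besselPair * (matMultiplier e 0 0 e * freeAdjugate a b w), ?_, ?_⟩
  · rw [mul_assoc, (freePencil_inverse he).2, mul_one]
  have hval : ∀ ξ, e ξ = ((((1 + ξ ^ 2)⁻¹ ^ 2 * (w ^ 2 +
      ((2 * Real.pi * ξ) ^ 2 + a) * ((2 * Real.pi * ξ) ^ 2 + b)))⁻¹ : ℝ) : ℂ) := fun ξ => by
    have h1 : e ξ * detSymbol a b w ξ = 1 := congrArg (fun φ : ℝ →ᵇ ℂ => φ ξ) he
    rw [eq_inv_of_mul_eq_one_left h1, detSymbol_apply]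
    push_cast
    rfl
  rw [freeAdjugate, besselPair, matMultiplier_mul, matMultiplier_mul]
  simp only [zero_mul, add_zero, zero_add]
  have hdiag : ∀ ξ, ‖(besselSymbol * (e * -(algebraMap ℂ (ℝ →ᵇ ℂ) w * besselSymbol))) ξ‖ ≤ b / a / w := by
    intro ξ
    have h1 : (0 : ℝ) < 1 + ξ ^ 2 := by positivity
    have h2 : (besselSymbol * (e * -(algebraMap ℂ (ℝ →ᵇ ℂ) w * besselSymbol))) ξ =
        ((-(w / (w ^ 2 + ((2 * Real.pi * ξ) ^ 2 + a) * ((2 * Real.pi * ξ) ^ 2 + b))) : ℝ) : ℂ) := by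
      simp only [BoundedContinuousFunction.mul_apply, BoundedContinuousFunction.neg_apply, hval,
        besselSymbol_apply, BoundedContinuousFunction.algebraMap_apply, smul_eq_mul, mul_one]
      norm_cast
      field_simp
    rw [h2, Complex.norm_real, norm_neg, Real.norm_of_nonneg (by positivity)]
    refine le_trans ?_ (div_le_div_of_nonneg_right ((one_le_div ha).2 hab) hw.le)
    rw [div_le_div_iff₀ (by positivity) hw]
    have : 0 < ((2 * Real.pi * ξ) ^ 2 + a) * ((2 * Real.pi * ξ) ^ 2 + b) := by positivity
    nlinarith
  have hoff : ∀ c ξ, ‖(besselSymbol * (e * shiftedSymbol c)) ξ‖ =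
      ‖((2 * Real.pi * ξ) ^ 2 + c) /
        (w ^ 2 + ((2 * Real.pi * ξ) ^ 2 + a) * ((2 * Real.pi * ξ) ^ 2 + b))‖ := by
    intro c ξ
    have h1 : (0 : ℝ) < 1 + ξ ^ 2 := by positivity
    rw [← Complex.norm_real]
    congr 1
    simp only [BoundedContinuousFunction.mul_apply, hval, besselSymbol_apply, shiftedSymbol_apply]
    norm_cast
    field_simp
  have hq : ∀ ξ, ‖(besselSymbol * (e * shiftedSymbol b)) ξ‖ ≤ b / a / w := fun ξ => by
    rw [hoff, Real.norm_of_nonneg (by positivity)]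
    refine symbol_ratio_bound ha hab (by positivity) (by positivity) ?_ hw
    nlinarith [sq_nonneg (2 * Real.pi * ξ)]
  have hp : ∀ ξ, ‖(besselSymbol * (e * shiftedSymbol a)) ξ‖ ≤ b / a / w := fun ξ => by
    refine le_trans ?_ (hq ξ)
    rw [hoff, hoff, Real.norm_of_nonneg (by positivity), Real.norm_of_nonneg (by positivity)]
    gcongr
  refine norm_matMultiplier_le (by positivity) hdiag (fun ξ => ?_) hp hdiag
  rw [mul_neg, mul_neg, BoundedContinuousFunction.neg_apply, norm_neg]
  exact hq ξ

/-- The sum factors as `(1 + V R)` times the free pencil, with `‖R‖ ≤ 4(b/a)/w`; the chosen `w`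
gives `‖V R‖ ≤ ‖V‖/(‖V‖ + 1) < 1`, and a Neumann series applies. -/
theorem exists_isUnit_freePencil_add {a b : ℝ} (ha : 0 < a) (hab : a ≤ b)
    (V : L2Pair →L[ℂ] L2Pair) :
    ∃ w : ℝ, 0 < w ∧ IsUnit (freePencil a b w + V * besselPair) := by
  have hb : 0 < b := ha.trans_le hab
  obtain ⟨w, hw⟩ : ∃ w : ℝ, w = 4 * (b / a) * (‖V‖ + 1) := ⟨_, rfl⟩
  have hw0 : 0 < w := by rw [hw]; positivity
  obtain ⟨R, hR, hRn⟩ := exists_besselPair_eq_mul_freePencil ha hab hw0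
  refine ⟨w, hw0, ?_⟩
  have hne : ∀ ξ : ℝ, ((w : ℂ)) ^ 2 +
      ((((2 * Real.pi * ξ) ^ 2 + a) * ((2 * Real.pi * ξ) ^ 2 + b) : ℝ) : ℂ) ≠ 0 := fun ξ => by
    have : 0 < w ^ 2 + ((2 * Real.pi * ξ) ^ 2 + a) * ((2 * Real.pi * ξ) ^ 2 + b) := by positivity
    exact_mod_cast this.ne'
  have h1 : freePencil a b w + V * besselPair = (1 - -(V * R)) * freePencil a b w := by
    rw [hR, sub_neg_eq_add, add_mul, one_mul, mul_assoc]
  rw [h1]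
  refine IsUnit.mul (isUnit_one_sub_of_norm_lt_one ?_) (isUnit_freePencil hne)
  rw [norm_neg]
  calc ‖V * R‖ ≤ ‖V‖ * (4 * (b / a / w)) :=
        (norm_mul_le _ _).trans (mul_le_mul_of_nonneg_left hRn (norm_nonneg _))
    _ = ‖V‖ / (‖V‖ + 1) := by
        rw [hw]
        have : ‖V‖ + 1 ≠ 0 := by positivity
        field_simp
    _ < 1 := (div_lt_one (by positivity)).2 (lt_add_one _)

/-- The determinant vanishes only at `±ξ₀`, a null set, so multiplication by it is injective;
composing with the adjugate carries this over to the pencil. -/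
theorem freePencil_injective {a b ξ₀ : ℝ} {z : ℂ} (ha : 0 < a) (hb : 0 < b)
    (hz : z ^ 2 = -((((2 * Real.pi * ξ₀) ^ 2 + a) * ((2 * Real.pi * ξ₀) ^ 2 + b) : ℝ) : ℂ)) :
    Function.Injective (freePencil a b z) := by
  have hne : ∀ᵐ ξ : ℝ, detSymbol a b z ξ ≠ 0 := by
    have hnull : volume ({ξ₀, -ξ₀} : Set ℝ) = 0 := (Set.toFinite _).measure_zero _
    filter_upwards [compl_mem_ae_iff.2 hnull] with ξ hξ h0
    apply hξ
    rw [detSymbol_apply, hz] at h0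
    have h1 : (((1 + ξ ^ 2)⁻¹ ^ 2 : ℝ) : ℂ) ≠ 0 := by
      exact_mod_cast (by positivity : (1 + ξ ^ 2)⁻¹ ^ 2 ≠ 0)
    have h2 := (mul_eq_zero.1 h0).resolve_left h1
    have h3 : -(((2 * Real.pi * ξ₀) ^ 2 + a) * ((2 * Real.pi * ξ₀) ^ 2 + b)) +
      ((2 * Real.pi * ξ) ^ 2 + a) * ((2 * Real.pi * ξ) ^ 2 + b) = 0 := by exact_mod_cast h2
    have h4 : (2 * Real.pi) ^ 2 * (ξ ^ 2 - ξ₀ ^ 2) *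
      ((2 * Real.pi * ξ) ^ 2 + (2 * Real.pi * ξ₀) ^ 2 + a + b) = 0 := by linear_combination h3
    have h5 : ξ ^ 2 - ξ₀ ^ 2 = 0 := by
      have h6 : (2 * Real.pi * ξ) ^ 2 + (2 * Real.pi * ξ₀) ^ 2 + a + b ≠ 0 := by positivity
      have h7 : (2 * Real.pi) ^ 2 ≠ 0 := by positivity
      exact (mul_eq_zero.1 ((mul_eq_zero.1 h4).resolve_right h6)).resolve_left h7
    exact sq_eq_sq_iff_eq_or_eq_neg.1 (sub_eq_zero.1 h5)
  have hinj : Function.Injective (matMultiplier (detSymbol a b z) 0 0 (detSymbol a b z)) := by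
    refine (injective_iff_map_eq_zero _).2 fun y hy => ?_
    rw [matMultiplier, block_apply, map_zero, zero_apply, zero_apply, zero_add, add_zero] at hy
    have hy' := congrArg WithLp.ofLp hy
    have h1 : multiplier (detSymbol a b z) y.fst = 0 := congrArg Prod.fst hy'
    have h2 : multiplier (detSymbol a b z) y.snd = 0 := congrArg Prod.snd hy'
    apply WithLp.ofLp_injective 2
    refine Prod.ext ?_ ?_
    · exact multiplier_injective hne (h1.trans (map_zero _).symm)
    · exact multiplier_injective hne (h2.trans (map_zero _).symm)
  rw [← freeAdjugate_mul_freePencil] at hinj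
  exact Function.Injective.of_comp (f := freeAdjugate a b z) hinj

/-- On the dispersion curve the constant coefficient operator is not bounded below. -/
theorem not_isUnit_freePencil {a b ξ₀ : ℝ} {z : ℂ} (hb : 0 < b)
    (hz : z ^ 2 = -((((2 * Real.pi * ξ₀) ^ 2 + a) * ((2 * Real.pi * ξ₀) ^ 2 + b) : ℝ) : ℂ)) :
    ¬IsUnit (freePencil a b z) := by
  rintro ⟨u, hu⟩
  obtain ⟨q, hq⟩ : ∃ q : ℝ, q = (2 * Real.pi * ξ₀) ^ 2 + b := ⟨_, rfl⟩
  have hq0 : 0 < q := by rw [hq]; positivity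
  obtain ⟨p, hp⟩ : ∃ p : ℝ, p = (2 * Real.pi * ξ₀) ^ 2 + a := ⟨_, rfl⟩
  rw [← hp, ← hq] at hz
  let μ : ℝ →ᵇ ℂ := shiftedSymbol a - algebraMap ℂ (ℝ →ᵇ ℂ) p * besselSymbol
  have hμb : μ = shiftedSymbol b - algebraMap ℂ (ℝ →ᵇ ℂ) q * besselSymbol := by
    ext ξ
    simp only [μ, BoundedContinuousFunction.sub_apply, BoundedContinuousFunction.mul_apply,
      shiftedSymbol_apply, besselSymbol_apply, BoundedContinuousFunction.algebraMap_apply, hp, hq,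
      smul_eq_mul]
    push_cast
    ring
  have hμ0 : μ ξ₀ = 0 := by
    simp only [μ, BoundedContinuousFunction.sub_apply, BoundedContinuousFunction.mul_apply,
      shiftedSymbol_apply, besselSymbol_apply, BoundedContinuousFunction.algebraMap_apply, hp,
      smul_eq_mul]
    push_cast
    ring
  let C := ‖(↑u⁻¹ : L2Pair →L[ℂ] L2Pair)‖
  -- Chosen so that `C(‖z‖ + q)δ = q C/(2(C + 1)) < q`, against the bound `q‖h‖ ≤ ‖y‖`.
  obtain ⟨δ, hδ⟩ : ∃ δ : ℝ, δ = q / (2 * (C + 1) * (‖z‖ + q)) := ⟨_, rfl⟩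
  have hδ0 : 0 < δ := by rw [hδ]; positivity
  obtain ⟨h, hh, hle⟩ := exists_norm_multiplier_le hμ0 hδ0
  -- `(q, z)` spans the kernel of the matrix with rows `(-z, q)` and `(-p, -z)`, which is the symbol
  -- at `ξ₀` up to a scalar; `h` is a wave packet concentrated near `ξ₀` in frequency.
  let y : L2Pair := WithLp.toLp 2 ((q : ℂ) • h, z • h)
  have hy : freePencil a b z y =
      WithLp.toLp 2 (z • multiplier μ h, (-(q : ℂ)) • multiplier μ h) := by
    rw [freePencil, matMultiplier, block_apply]
    apply WithLp.ofLp_injective 2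
    refine Prod.ext ?_ ?_
    · change multiplier _ ((q : ℂ) • h) + multiplier _ (z • h) = z • multiplier μ h
      rw [hμb]
      simp only [map_neg, map_sub, Algebra.algebraMap_eq_smul_one,
        smul_mul_assoc, one_mul, neg_apply, smul_apply, sub_apply, map_smul]
      module
    · change multiplier _ ((q : ℂ) • h) + multiplier _ (z • h) = (-(q : ℂ)) • multiplier μ h
      simp only [μ, map_neg, map_sub, Algebra.algebraMap_eq_smul_one,
        smul_mul_assoc, one_mul, neg_apply, smul_apply, sub_apply, map_smul]
      have h1 : z • z • multiplier besselSymbol h = (-((p * q : ℝ) : ℂ)) • multiplier besselSymbol h := by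
        rw [smul_smul, ← sq, hz]
      simp only [smul_neg]
      rw [h1]
      push_cast
      module
  have hinv : (↑u⁻¹ : L2Pair →L[ℂ] L2Pair) (freePencil a b z y) = y := by
    rw [← hu]
    exact congrArg (fun Z : L2Pair →L[ℂ] L2Pair => Z y) u.inv_mul
  have h1 : q * ‖h‖ ≤ ‖y‖ := by
    have := WithLp.norm_fst_le L2 y
    change ‖(q : ℂ) • h‖ ≤ ‖y‖ at this
    rwa [norm_smul, Complex.norm_real, Real.norm_of_nonneg hq0.le] at this
  have h2 : ‖y‖ ≤ C * ((‖z‖ + q) * (δ * ‖h‖)) := by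
    conv_lhs => rw [← hinv]
    refine (ContinuousLinearMap.le_opNorm _ _).trans (mul_le_mul_of_nonneg_left ?_ (norm_nonneg _))
    rw [hy]
    refine (norm_toLp_le _ _).trans ?_
    rw [norm_smul, norm_smul, norm_neg, Complex.norm_real, Real.norm_of_nonneg hq0.le, ← add_mul]
    exact mul_le_mul_of_nonneg_left hle (by positivity)
  have hh0 : 0 < ‖h‖ := norm_pos_iff.2 hh
  have hC : 0 ≤ C := norm_nonneg _
  have h3 : C * ((‖z‖ + q) * (δ * ‖h‖)) = C / (2 * (C + 1)) * (q * ‖h‖) := by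
    rw [hδ]
    have : ‖z‖ + q ≠ 0 := by positivity
    field_simp
  have h4 : C / (2 * (C + 1)) < 1 := (div_lt_one (by positivity)).2 (by linarith)
  have h5 : 0 < q * ‖h‖ := by positivity
  nlinarith

end LugiatoLefever
end

/-! ### The linearized operator -/

noncomputable section

namespace LugiatoLefever

open UnboundedOperator
open scoped BoundedContinuousFunction FourierTransform

/-! ### Convergence of the steady states to `ψ₀` at infinity -/

theorem rate_pos {α : ℝ} (hα : 0 < α) : 0 < rate α := by
  have := Real.sinh_pos_iff.2 hα
  unfold rate
  positivity

theorem one_add_sq_le_cosh_sq (y : ℝ) : 1 + y ^ 2 ≤ Real.cosh y ^ 2 := by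
  rw [Real.cosh_sq' y]
  have : y ^ 2 ≤ Real.sinh y ^ 2 := by
    rw [sq_le_sq, Real.abs_sinh]
    exact Real.self_le_sinh_iff.2 (abs_nonneg y)
  linarith

theorem memLp_inv_cosh {A : ℝ} (hA : A ≠ 0) :
    MemLp (fun x : ℝ => (Real.cosh (A * x))⁻¹) 2 := by
  have hc : Continuous fun x : ℝ => (Real.cosh (A * x))⁻¹ :=
    (by fun_prop : Continuous fun x : ℝ => Real.cosh (A * x)).inv₀ fun x => (Real.cosh_pos _).ne'
  refine (memLp_two_iff_integrable_sq hc.aestronglyMeasurable).2 ?_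
  refine (integrable_inv_one_add_sq.comp_mul_left' hA).mono' (hc.pow 2).aestronglyMeasurable
    (Eventually.of_forall fun x => ?_)
  rw [Real.norm_of_nonneg (by positivity), inv_pow]
  exact inv_anti₀ (by positivity) (one_add_sq_le_cosh_sq _)

/-- One bound for both signs: for `s = -1` it uses `cosh ≥ 1` to absorb the constant. It shows that
`u₋` has no poles and that both states approach `ψ₀` exponentially. -/
theorem le_abs_denominator (s : ℤˣ) (α x : ℝ) :
    (Real.cosh α - 1) * Real.cosh (rate α * x) ≤
      |1 + ((s : ℤ) : ℝ) * (Real.cosh α * Real.cosh (rate α * x))| := by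
  have h2 : 1 ≤ Real.cosh (rate α * x) := Real.one_le_cosh _
  rcases Int.units_eq_one_or s with rfl | rfl
  · refine le_trans ?_ (le_abs_self _)
    simp only [Units.val_one, Int.cast_one, one_mul]
    linarith
  · refine le_trans ?_ (neg_le_abs _)
    simp only [Units.val_neg, Units.val_one, Int.cast_neg, Int.cast_one]
    linarith

theorem continuous_steadyState (s : ℤˣ) {α : ℝ} (hα : 0 < α) : Continuous (steadyState s α) := by
  have h1 : 1 < Real.cosh α := Real.one_lt_cosh.2 hα.ne'
  unfold steadyState
  refine continuous_const.mul (continuous_const.add (continuous_const.div (by fun_prop) fun x => ?_))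
  rw [← abs_pos]
  exact (mul_pos (sub_pos.2 h1) (Real.cosh_pos _)).trans_le (le_abs_denominator s α x)

theorem abs_steadyState_sub_psi0_le (s : ℤˣ) {α : ℝ} (hα : 0 < α) (x : ℝ) :
    |steadyState s α x - psi0 α| ≤ |psi0 α| * (2 * (Real.cosh α + 1)) * (Real.cosh (rate α * x))⁻¹ := by
  have h1 : 1 < Real.cosh α := Real.one_lt_cosh.2 hα.ne'
  have hC := Real.cosh_pos (rate α * x)
  have hd := le_abs_denominator s α x
  have hs : Real.sinh α ^ 2 = (Real.cosh α - 1) * (Real.cosh α + 1) := by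
    rw [Real.sinh_sq]; ring
  have hpos : 0 < (Real.cosh α - 1) * Real.cosh (rate α * x) := mul_pos (sub_pos.2 h1) hC
  have h2 : steadyState s α x - psi0 α = psi0 α * (2 * Real.sinh α ^ 2 /
      (1 + ((s : ℤ) : ℝ) * (Real.cosh α * Real.cosh (rate α * x)))) := by
    unfold steadyState
    ring
  rw [h2, abs_mul, mul_assoc]
  refine mul_le_mul_of_nonneg_left ?_ (abs_nonneg _)
  rw [abs_div, abs_of_nonneg (by positivity : 0 ≤ 2 * Real.sinh α ^ 2), ← div_eq_mul_inv,
    div_le_div_iff₀ (hpos.trans_le hd) hC, hs]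
  nlinarith

/-- The deviation of the squared steady state from its value at infinity is a bounded continuous
and square integrable function. -/
theorem exists_potential (s : ℤˣ) {α : ℝ} (hα : 0 < α) :
    ∃ v : ℝ →ᵇ ℂ, (∀ x, v x = ((steadyState s α x ^ 2 - psi0 α ^ 2 : ℝ) : ℂ)) ∧
      MemLp v 2 (volume : Measure ℝ) := by
  obtain ⟨M, hM⟩ : ∃ M : ℝ, M = |psi0 α| * (2 * (Real.cosh α + 1)) *
    (|psi0 α| * (1 + 2 * (Real.cosh α + 1)) + |psi0 α|) := ⟨_, rfl⟩
  have hcosh := Real.cosh_pos α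
  have hM0 : 0 ≤ M := by rw [hM]; positivity
  have hbound : ∀ x, ‖((steadyState s α x ^ 2 - psi0 α ^ 2 : ℝ) : ℂ)‖ ≤
      M * (Real.cosh (rate α * x))⁻¹ := by
    intro x
    rw [Complex.norm_real, Real.norm_eq_abs, sq_sub_sq, abs_mul, hM, mul_right_comm, mul_comm |_ + _|]
    refine mul_le_mul (abs_steadyState_sub_psi0_le s hα x) ?_ (abs_nonneg _) ?_
    · exact (abs_add_le _ _).trans (add_le_add_left (abs_steadyState_le s α x) _)
    · have := Real.cosh_pos (rate α * x)
      positivity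
  have hcont : Continuous fun x => ((steadyState s α x ^ 2 - psi0 α ^ 2 : ℝ) : ℂ) :=
    Complex.continuous_ofReal.comp (((continuous_steadyState s hα).pow 2).sub continuous_const)
  refine ⟨BoundedContinuousFunction.ofNormedAddCommGroup _ hcont M fun x => (hbound x).trans ?_,
    fun x => rfl, ?_⟩
  · exact mul_le_of_le_one_right hM0 (inv_le_one_of_one_le₀ (Real.one_le_cosh _))
  · refine MemLp.of_le_mul (c := M) (memLp_inv_cosh (rate_pos hα).ne') hcont.aestronglyMeasurable
      (Eventually.of_forall fun x => ?_)
    have := Real.cosh_pos (rate α * x)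
    rw [Real.norm_of_nonneg (by positivity : 0 ≤ (Real.cosh (rate α * x))⁻¹)]
    exact hbound x

/-! ### The linearized operator as a pencil of bounded operators -/

theorem mulSq_eq {s : ℤˣ} {α : ℝ} {v : ℝ →ᵇ ℂ}
    (hv : ∀ x, v x = ((steadyState s α x ^ 2 - psi0 α ^ 2 : ℝ) : ℂ)) (f : L2) :
    mulSq s α f = ((psi0 α ^ 2 : ℝ) : ℂ) • f + mulCLM v f := by
  refine Lp.ext ?_
  filter_upwards [coeFn_mulSq s α f, coeFn_mulCLM v f, Lp.coeFn_smul ((psi0 α ^ 2 : ℝ) : ℂ) f,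
    Lp.coeFn_add (((psi0 α ^ 2 : ℝ) : ℂ) • f) (mulCLM v f)] with x h1 h2 h3 h4
  rw [h4, Pi.add_apply, h1, h2, h3, Pi.smul_apply, hv, smul_eq_mul, ← add_mul]
  push_cast
  ring

theorem schrodinger_multiplier {s : ℤˣ} {α : ℝ} {v : ℝ →ᵇ ℂ}
    (hv : ∀ x, v x = ((steadyState s α x ^ 2 - psi0 α ^ 2 : ℝ) : ℂ)) (c : ℝ) (h : L2) :
    schrodinger c s α ⟨multiplier besselSymbol h, multiplier_besselSymbol_mem h⟩ =
      multiplier (shiftedSymbol (1 - c * psi0 α ^ 2)) h -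
        (c : ℂ) • mulCLM v (multiplier besselSymbol h) := by
  change -secondDeriv ⟨multiplier besselSymbol h, multiplier_besselSymbol_mem h⟩ +
    multiplier besselSymbol h - (c : ℂ) • mulSq s α (multiplier besselSymbol h) = _
  rw [secondDeriv_multiplier_besselSymbol, mulSq_eq hv, shiftedSymbol, map_add, map_mul,
    AlgHom.commutes, Algebra.algebraMap_eq_smul_one, smul_one_mul, add_apply, smul_apply]
  push_cast
  module

/-- The bounded part `(y₁, y₂) ↦ (-2 v y₂, 6 v y₁)` of the linearized operator. -/
def perturbation (v : ℝ →ᵇ ℂ) : L2Pair →L[ℂ] L2Pair :=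
  block 0 ((-2 : ℂ) • mulCLM v) ((6 : ℂ) • mulCLM v) 0

theorem perturbation_mul_besselPair (v : ℝ →ᵇ ℂ) :
    perturbation v * besselPair = block 0 ((-2 : ℂ) • (mulCLM v ∘L multiplier besselSymbol))
      ((6 : ℂ) • (mulCLM v ∘L multiplier besselSymbol)) 0 := by
  rw [perturbation, besselPair, matMultiplier, block_mul]
  simp only [map_zero, mul_zero, zero_mul, add_zero, zero_add, smul_mul_assoc]
  rfl

theorem perturbation_mul_besselPair_mem {v : ℝ →ᵇ ℂ} (hv : MemLp v 2 (volume : Measure ℝ)) :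
    perturbation v * besselPair ∈ approxFiniteRank L2Pair L2Pair := by
  rw [perturbation_mul_besselPair]
  have h := mulCLM_comp_multiplier_mem hv
  exact block_mem_approxFiniteRank (zero_mem _) (Submodule.smul_mem _ _ h)
    (Submodule.smul_mem _ _ h) (zero_mem _)

theorem freePencil_zero_sub (a b : ℝ) (z : ℂ) :
    freePencil a b 0 - z • besselPair = freePencil a b z := by
  rw [sub_eq_iff_eq_add, besselPair, freePencil, freePencil, matMultiplier, matMultiplier,
    matMultiplier, block_smul, block_add]
  simp [Algebra.algebraMap_eq_smul_one]

theorem besselPair_apply (y : L2Pair) : besselPair y = WithLp.toLp 2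
    (multiplier besselSymbol y.fst, multiplier besselSymbol y.snd) := by
  rw [besselPair, matMultiplier, block_apply]
  simp

theorem isPencil_opJL {s : ℤˣ} {α : ℝ} {v : ℝ →ᵇ ℂ}
    (hv : ∀ x, v x = ((steadyState s α x ^ 2 - psi0 α ^ 2 : ℝ) : ℂ)) :
    IsPencil (opJL s α) besselPair
      (freePencil (1 - 6 * psi0 α ^ 2) (1 - 2 * psi0 α ^ 2) 0 + perturbation v * besselPair) where
  injective := by
    refine (injective_iff_map_eq_zero _).2 fun y hy => ?_
    rw [besselPair_apply] at hy
    have hy' := congrArg WithLp.ofLp hy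
    apply WithLp.ofLp_injective 2
    refine Prod.ext ?_ ?_
    · exact multiplier_besselSymbol_injective ((congrArg Prod.fst hy').trans (map_zero _).symm)
    · exact multiplier_besselSymbol_injective ((congrArg Prod.snd hy').trans (map_zero _).symm)
  mem_domain y := by
    rw [besselPair_apply]
    exact ⟨multiplier_besselSymbol_mem _, multiplier_besselSymbol_mem _⟩
  exists_eq x := by
    obtain ⟨f, hf⟩ := exists_multiplier_besselSymbol_eq x.2.1
    obtain ⟨g, hg⟩ := exists_multiplier_besselSymbol_eq x.2.2
    refine ⟨WithLp.toLp 2 (f, g), ?_⟩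
    rw [besselPair_apply]
    apply WithLp.ofLp_injective 2
    exact Prod.ext hf hg
  apply_eq y := by
    have h6 := schrodinger_multiplier hv 6 y.fst
    have h2 := schrodinger_multiplier hv 2 y.snd
    have hx : ∀ (x : L2Pair) (hx : x ∈ (opJL s α).domain), x = WithLp.toLp 2
        (multiplier besselSymbol y.fst, multiplier besselSymbol y.snd) →
        opJL s α ⟨x, hx⟩ = WithLp.toLp 2
          (schrodinger 2 s α ⟨_, multiplier_besselSymbol_mem y.snd⟩,
            -schrodinger 6 s α ⟨_, multiplier_besselSymbol_mem y.fst⟩) := by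
      rintro x hx rfl
      rfl
    rw [hx _ _ (besselPair_apply y), add_apply, perturbation_mul_besselPair, freePencil,
      matMultiplier, block_apply, block_apply]
    rw [Complex.ofReal_ofNat] at h2 h6
    rw [h2, h6]
    apply WithLp.ofLp_injective 2
    refine Prod.ext ?_ ?_
    · change multiplier _ y.snd - (2 : ℂ) • mulCLM v (multiplier besselSymbol y.snd) =
        (multiplier _ y.fst + multiplier _ y.snd) +
          ((0 : L2 →L[ℂ] L2) y.fst + (-2 : ℂ) • mulCLM v (multiplier besselSymbol y.snd))
      rw [map_zero (algebraMap ℂ (ℝ →ᵇ ℂ)), zero_mul, neg_zero, map_zero, zero_apply]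
      module
    · change -(multiplier _ y.fst - (6 : ℂ) • mulCLM v (multiplier besselSymbol y.fst)) =
        (multiplier (-shiftedSymbol _) y.fst + multiplier _ y.snd) +
          ((6 : ℂ) • mulCLM v (multiplier besselSymbol y.fst) + (0 : L2 →L[ℂ] L2) y.snd)
      rw [map_zero (algebraMap ℂ (ℝ →ᵇ ℂ)), zero_mul, neg_zero, map_zero, zero_apply, map_neg,
        neg_apply]
      module

end LugiatoLefever
end

/-! ### The essential spectrum -/

namespace LugiatoLefever

open UnboundedOperator
open scoped BoundedContinuousFunction

/-- The part of the imaginary axis at distance at least `r` from the origin. -/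
def imaginaryRays (r : ℝ) : Set ℂ := {z : ℂ | ∃ l : ℝ, z = Complex.I * (l : ℂ) ∧ r ≤ |l|}

/-- The complement is star-shaped about `0`: if `t z` with `0 < t ≤ 1` is on a ray, so is `z`. -/
theorem isPreconnected_compl_imaginaryRays {r : ℝ} (hr : 0 < r) :
    IsPreconnected (imaginaryRays r)ᶜ := by
  have h0 : (0 : ℂ) ∈ (imaginaryRays r)ᶜ := by
    rintro ⟨l, hl, hrl⟩
    have : l = 0 := by simpa using hl.symm
    rw [this, abs_zero] at hrl
    exact hr.not_ge hrl
  have hstar : StarConvex ℝ 0 (imaginaryRays r)ᶜ := by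
    rw [starConvex_zero_iff]
    rintro z hz t ht0 ht1 ⟨l, hl, hrl⟩
    rcases ht0.eq_or_lt with rfl | ht
    · exact h0 ⟨l, by simpa using hl, hrl⟩
    · refine hz ⟨l / t, ?_, ?_⟩
      · have ht' : (t : ℂ) ≠ 0 := by exact_mod_cast ht.ne'
        rw [Complex.real_smul] at hl
        push_cast
        field_simp
        linear_combination hl
      · rw [abs_div, abs_of_pos ht, le_div_iff₀ ht]
        nlinarith
  exact (hstar.isPathConnected h0).isConnected.isPreconnected

theorem sq_add_ne_zero_of_notMem {a b : ℝ} (ha : 0 < a) (hb : 0 < b) {z : ℂ}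
    (hz : z ∉ imaginaryRays √(a * b)) (ξ : ℝ) :
    z ^ 2 + ((((2 * Real.pi * ξ) ^ 2 + a) * ((2 * Real.pi * ξ) ^ 2 + b) : ℝ) : ℂ) ≠ 0 := by
  intro h
  obtain ⟨m, hm⟩ : ∃ m, m = ((2 * Real.pi * ξ) ^ 2 + a) * ((2 * Real.pi * ξ) ^ 2 + b) := ⟨_, rfl⟩
  have hle : a * b ≤ m := by
    rw [hm]
    exact mul_le_mul (by nlinarith [sq_nonneg (2 * Real.pi * ξ)])
      (by nlinarith [sq_nonneg (2 * Real.pi * ξ)]) hb.le (by positivity)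
  have hm0 : 0 ≤ m := (mul_pos ha hb).le.trans hle
  rw [← hm] at h
  have hs : (((√m : ℝ) : ℂ)) ^ 2 = (m : ℂ) := by exact_mod_cast Real.sq_sqrt hm0
  have hfac : z ^ 2 = (Complex.I * ((√m : ℝ) : ℂ)) ^ 2 := by
    rw [mul_pow, hs, Complex.I_sq]
    linear_combination h
  have hsqrt : √(a * b) ≤ |√m| := by
    rw [abs_of_nonneg (Real.sqrt_nonneg m)]
    exact Real.sqrt_le_sqrt hle
  rcases sq_eq_sq_iff_eq_or_eq_neg.1 hfac with h1 | h1
  · exact hz ⟨√m, h1, hsqrt⟩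
  · exact hz ⟨-√m, by rw [h1]; push_cast; ring, by rwa [abs_neg]⟩

/-- With `z = il`, the intermediate value theorem for `(t + a)(t + b)` on `[0, |l|]` yields the
value `l²`; then `ξ = √t/(2π)`. -/
theorem exists_dispersion {a b : ℝ} (ha : 0 < a) (hb : 0 < b) {z : ℂ}
    (hz : z ∈ imaginaryRays √(a * b)) :
    ∃ ξ : ℝ, z ^ 2 = -((((2 * Real.pi * ξ) ^ 2 + a) * ((2 * Real.pi * ξ) ^ 2 + b) : ℝ) : ℂ) := by
  obtain ⟨l, rfl, hl⟩ := hz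
  have hc : ContinuousOn (fun t : ℝ => (t + a) * (t + b)) (Set.Icc 0 |l|) := by fun_prop
  have h1 : l ^ 2 ∈ Set.Icc ((0 + a) * (0 + b)) ((|l| + a) * (|l| + b)) := by
    constructor
    · rw [zero_add, zero_add, ← sq_abs]
      exact (Real.sqrt_le_left (abs_nonneg l)).1 hl
    · rw [← sq_abs]
      nlinarith [abs_nonneg l, mul_nonneg (abs_nonneg l) ha.le, mul_nonneg (abs_nonneg l) hb.le,
        mul_pos ha hb]
  obtain ⟨t, ht, htl⟩ := intermediate_value_Icc (abs_nonneg l) hc h1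
  replace htl : (t + a) * (t + b) = l ^ 2 := htl
  refine ⟨√t / (2 * Real.pi), ?_⟩
  have h2 : (2 * Real.pi * (√t / (2 * Real.pi))) ^ 2 = t := by
    have := Real.pi_ne_zero
    rw [mul_div_cancel₀ _ (by positivity), Real.sq_sqrt ht.1]
  rw [h2, mul_pow, Complex.I_sq, htl]
  push_cast
  ring

theorem psi0_sq (α : ℝ) : psi0 α ^ 2 = (2 * (1 + 2 * Real.cosh α ^ 2))⁻¹ := by
  rw [psi0, div_pow, one_pow, Real.sq_sqrt (by positivity), one_div]

/-- `6ψ₀² = 3/(1 + 2cosh²α)`, which is below `1` exactly because `cosh α > 1`. -/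
theorem one_sub_psi0_pos {α : ℝ} (hα : 0 < α) : 0 < 1 - 6 * psi0 α ^ 2 := by
  have h1 : 1 < Real.cosh α := Real.one_lt_cosh.2 hα.ne'
  rw [psi0_sq, sub_pos, ← div_eq_mul_inv, div_lt_one (by positivity)]
  nlinarith

/-- The part of the imaginary axis beyond the threshold belongs to the spectrum. -/
theorem imaginaryRays_subset_spectrum (s : ℤˣ) {α : ℝ} (hα : 0 < α) :
    imaginaryRays √((1 - 6 * psi0 α ^ 2) * (1 - 2 * psi0 α ^ 2)) ⊆
      UnboundedOperator.spectrum (opJL s α) := by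
  intro z hz hres
  have ha := one_sub_psi0_pos hα
  have hb : 0 < 1 - 2 * psi0 α ^ 2 := by nlinarith [sq_nonneg (psi0 α)]
  obtain ⟨v, hv, hv2⟩ := exists_potential s hα
  obtain ⟨ξ, hξ⟩ := exists_dispersion ha hb hz
  rw [(isPencil_opJL hv).mem_resolventSet_iff, add_sub_right_comm, freePencil_zero_sub] at hres
  -- Removing the perturbation from the supposedly invertible pencil leaves the free pencil Fredholm
  -- of index zero; being injective it would be invertible.
  have h := IsUnitAddFiniteRank.of_isUnit_add hres
    (neg_mem (perturbation_mul_besselPair_mem hv2))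
  rw [add_neg_cancel_right] at h
  exact not_isUnit_freePencil hb hξ (h.isUnit_of_injective (freePencil_injective ha hb hξ))

theorem isDiscreteEigenvalue_of_notMem (s : ℤˣ) {α : ℝ} (hα : 0 < α) {z : ℂ}
    (hz : z ∉ imaginaryRays √((1 - 6 * psi0 α ^ 2) * (1 - 2 * psi0 α ^ 2)))
    (hs : z ∈ UnboundedOperator.spectrum (opJL s α)) : IsDiscreteEigenvalue (opJL s α) z := by
  have ha := one_sub_psi0_pos hα
  have hab : 1 - 6 * psi0 α ^ 2 ≤ 1 - 2 * psi0 α ^ 2 := by nlinarith [sq_nonneg (psi0 α)]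
  have hb := ha.trans_le hab
  have hr : 0 < √((1 - 6 * psi0 α ^ 2) * (1 - 2 * psi0 α ^ 2)) := Real.sqrt_pos.2 (mul_pos ha hb)
  obtain ⟨v, hv, hv2⟩ := exists_potential s hα
  obtain ⟨w, hw, hwu⟩ := exists_isUnit_freePencil_add ha hab (perturbation v)
  refine (isPencil_opJL hv).isDiscreteEigenvalue (isPreconnected_compl_imaginaryRays hr)
    (fun ζ hζ => ?_) (w := w) ?_ ?_ hz hs
  · rw [add_sub_right_comm, freePencil_zero_sub]
    exact .of_isUnit_add (isUnit_freePencil (sq_add_ne_zero_of_notMem ha hb hζ))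
      (perturbation_mul_besselPair_mem hv2)
  · rintro ⟨l, hl, -⟩
    have := congrArg Complex.re hl
    rw [Complex.ofReal_re, Complex.I_mul_re, Complex.ofReal_im, neg_zero] at this
    exact hw.ne' this
  · rwa [add_sub_right_comm, freePencil_zero_sub]

/-- The rays have no isolated points. -/
theorem frequently_mem_imaginaryRays {r : ℝ} (hr : 0 < r) {z : ℂ} (hz : z ∈ imaginaryRays r) :
    ∃ᶠ w in 𝓝[≠] z, w ∈ imaginaryRays r := by
  obtain ⟨l, rfl, hl⟩ := hz
  have hl0 : l ≠ 0 := by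
    rintro rfl
    rw [abs_zero] at hl
    exact hr.not_ge hl
  have hlim : Tendsto (fun t : ℝ => Complex.I * (((1 + t) * l : ℝ) : ℂ)) (𝓝[>] 0)
      (𝓝[≠] (Complex.I * (l : ℂ))) := by
    refine tendsto_nhdsWithin_iff.2 ⟨?_, ?_⟩
    · have hc : Continuous fun t : ℝ => Complex.I * (((1 + t) * l : ℝ) : ℂ) := by fun_prop
      have := hc.tendsto 0
      rw [add_zero, one_mul] at this
      exact this.mono_left nhdsWithin_le_nhds
    · filter_upwards [self_mem_nhdsWithin] with t ht h
      have h1 : (1 + t) * l = l := by exact_mod_cast mul_left_cancel₀ Complex.I_ne_zero h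
      have h2 : t * l = 0 := by linear_combination h1
      exact (mul_ne_zero (ne_of_gt ht) hl0) h2
  refine hlim.frequently (Eventually.frequently ?_)
  filter_upwards [self_mem_nhdsWithin] with t ht
  refine ⟨_, rfl, ?_⟩
  have ht' : 0 < t := ht
  rw [abs_mul, abs_of_pos (by linarith)]
  nlinarith [abs_nonneg l]

end LugiatoLefever

theorem lemma2p1 (s : ℤˣ) (α : ℝ) (hα : 0 < α) :
    UnboundedOperator.essentialSpectrum (LugiatoLefever.opJL s α) =
      {z : ℂ | ∃ l : ℝ, z = Complex.I * (l : ℂ) ∧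
        √((1 - 6 * LugiatoLefever.psi0 α ^ 2) * (1 - 2 * LugiatoLefever.psi0 α ^ 2)) ≤ |l|} := by
  change _ = LugiatoLefever.imaginaryRays _
  have ha := LugiatoLefever.one_sub_psi0_pos hα
  have hb : 0 < 1 - 2 * LugiatoLefever.psi0 α ^ 2 := by nlinarith [sq_nonneg (LugiatoLefever.psi0 α)]
  have hsub := LugiatoLefever.imaginaryRays_subset_spectrum s hα
  refine Set.Subset.antisymm (fun z hz => ?_) fun z hz => ⟨hsub hz, fun hp => ?_⟩
  · by_contra hn
    exact hz.2 ⟨hz.1, LugiatoLefever.isDiscreteEigenvalue_of_notMem s hα hn hz.1⟩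
  -- A discrete eigenvalue is isolated in the spectrum, while `z` is a limit of other points of the
  -- rays, all of them spectral.
  · have hf := LugiatoLefever.frequently_mem_imaginaryRays (Real.sqrt_pos.2 (mul_pos ha hb)) hz
    obtain ⟨w, hw, hw'⟩ := (hf.and_eventually hp.2.isolated).exists
    exact hw' (hsub hw)
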